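/- Let $\mathcal H_{\mathsf A},\mathcal H_{\mathsf B}$ be finite-dimensional complex Hilbert spaces. A positive operator on a bipartite space is separable if it is a finite sum $\sum_i \tau_i\otimes\omega_i$ with $\tau_i,\omega_i\ge 0$; a state (positive operator of trace $1$) is entangled if it is not separable. A completely positive map between operators on bipartite spaces is non-entangling if it maps every separable operator to a separable operator. It is dually non-entangling if both it and its dual $\Lambda^*$, defined by $\operatorname{Tr}(\Lambda(X)Y)=\operatorname{Tr}(X\Lambda^*(Y))$ for all $X,Y$, are non-entangling. Let $\phi_2^+=|\phi_2^+\rangle\langle\phi_2^+|$ with $|\phi_2^+\rangle=(|00\rangle+|11\rangle)/\sqrt2$. A bipartite state $\sigma$ is LOCC-distillable if there are LOCC channels $\Lambda_n$ (local operations and finitely many rounds of classical communication) from $n$ copies to two qubits with $\lim_{n\to\infty}\|\Lambda_n(\sigma^{\otimes n})-\phi_2^+\|_1=0$, where $\|\cdot\|_1$ is the trace norm. An entanglement witness is a Hermitian operator $W$ with $\operatorname{Tr}(W\sigma)\ge0$ for every separable state $\sigma$. **Theorem.** For every entangled state $\rho$ on $\mathcal H_{\mathsf A}\otimes\mathcal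 H_{\mathsf B}$ there is a quantum channel $\Lambda:\mathcal L(\mathcal H_{\mathsf A}\otimes\mathcal H_{\mathsf B})\to\mathcal L(\mathbb C^2\otimes\mathbb C^2)$ such that 1. $\Lambda$ is dually non-entangling; 2. the two-qubit state $\Lambda(\rho)$ satisfies $\operatorname{Tr}(\Lambda(\rho)\,\phi_2^+)>1/2$; 3. $\Lambda(\rho)$ is LOCC-distillable. Moreover, $\Lambda$ can be chosen of the form $$\Lambda(X)=\operatorname{Tr}(AX)\,\tfrac14\mathbf 1_4+\operatorname{Tr}((\mathbf 1-A)X)\,\phi_2^+,\qquad A=\tfrac13(W+2\cdot\mathbf 1),$$ where $W$ is an entanglement witness with Frobenius norm $\|W\|_2\le1$ and $\operatorname{Tr}(W\rho)<0$. -/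

import Mathlib

open scoped Kronecker ComplexOrder

noncomputable section

/-! Operators on a finite-dimensional Hilbert space with orthonormal basis `A` are matrices
`Matrix A A ℂ`; the basis of a bipartite space `A : B` is `A × B`. -/

/-- Density operators. -/
def IsState {A : Type*} [Fintype A] (ρ : Matrix A A ℂ) : Prop :=
  ρ.PosSemidef ∧ ρ.trace = 1

/-- Separable (not necessarily normalised) positive operators with respect to `A : B`. -/
def IsSeparableOperator {A B : Type*} (σ : Matrix (A × B) (A × B) ℂ) : Prop :=
  ∃ (m : ℕ) (τ : Fin m → Matrix A A ℂ) (ω : Fin m → Matrix B B ℂ),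
    (∀ i, (τ i).PosSemidef) ∧ (∀ i, (ω i).PosSemidef) ∧ σ = ∑ i, τ i ⊗ₖ ω i

/-- Entangled states with respect to `A : B`. -/
def IsEntangledState {A B : Type*} [Fintype A] [Fintype B]
    (ρ : Matrix (A × B) (A × B) ℂ) : Prop :=
  IsState ρ ∧ ¬ IsSeparableOperator ρ

/-- Entanglement witnesses with respect to `A : B`
(the trace below is real, as `W` and `σ` are Hermitian). -/
def IsEntanglementWitness {A B : Type*} [Fintype A] [Fintype B]
    (W : Matrix (A × B) (A × B) ℂ) : Prop :=
  W.IsHermitian ∧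
    ∀ σ : Matrix (A × B) (A × B) ℂ, IsState σ → IsSeparableOperator σ → 0 ≤ (W * σ).trace.re

open scoped Matrix.Norms.Frobenius in
/-- The Frobenius norm of a matrix. -/
def frobeniusNorm {A : Type*} [Fintype A] (X : Matrix A A ℂ) : ℝ := ‖X‖

/-- The trace norm: the sum of the singular values. -/
def traceNorm {A : Type*} [Fintype A] [DecidableEq A] (X : Matrix A A ℂ) : ℝ :=
  ∑ i, √((Matrix.isHermitian_conjTranspose_mul_self X).eigenvalues i)

/-- `ampliation k Λ` is `id ⊗ Λ` on `ℂᵏ ⊗ A`: `Λ` is applied to every block. -/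
def ampliation {A A' : Type*} (k : ℕ) (Λ : Matrix A A ℂ →ₗ[ℂ] Matrix A' A' ℂ)
    (M : Matrix (Fin k × A) (Fin k × A) ℂ) : Matrix (Fin k × A') (Fin k × A') ℂ :=
  Matrix.of fun p q => Λ (Matrix.of fun x y => M (p.1, x) (q.1, y)) p.2 q.2

/-- Complete positivity: every ampliation preserves positive semidefiniteness. -/
def IsCompletelyPositive {A A' : Type*} (Λ : Matrix A A ℂ →ₗ[ℂ] Matrix A' A' ℂ) : Prop :=
  ∀ (k : ℕ) (M : Matrix (Fin k × A) (Fin k × A) ℂ),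
    M.PosSemidef → (ampliation k Λ M).PosSemidef

/-- Trace preservation. -/
def IsTracePreserving {A A' : Type*} [Fintype A] [Fintype A']
    (Λ : Matrix A A ℂ →ₗ[ℂ] Matrix A' A' ℂ) : Prop :=
  ∀ X, (Λ X).trace = X.trace

/-- Quantum channels (CPTP maps). -/
def IsQuantumChannel {A A' : Type*} [Fintype A] [Fintype A']
    (Λ : Matrix A A ℂ →ₗ[ℂ] Matrix A' A' ℂ) : Prop :=
  IsCompletelyPositive Λ ∧ IsTracePreserving Λ

/-- The dual map `Λ*`, characterised by `Tr(Λ(X) Y) = Tr(X Λ*(Y))`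
(see `trace_map_mul` and `eq_dualMap`). -/
def dualMap {A A' : Type*} [Fintype A'] [DecidableEq A]
    (Λ : Matrix A A ℂ →ₗ[ℂ] Matrix A' A' ℂ) : Matrix A' A' ℂ →ₗ[ℂ] Matrix A A ℂ where
  toFun Y := Matrix.of fun i j => (Λ (Matrix.single j i 1) * Y).trace
  map_add' Y Z := by
    ext i j
    simp [mul_add]
  map_smul' c Y := by
    ext i j
    simp

theorem trace_map_mul {A A' : Type*} [Fintype A] [Fintype A'] [DecidableEq A]
    (Λ : Matrix A A ℂ →ₗ[ℂ] Matrix A' A' ℂ) (X : Matrix A A ℂ) (Y : Matrix A' A' ℂ) :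
    (Λ X * Y).trace = (X * dualMap Λ Y).trace := by
  have hX : Λ X = ∑ i, ∑ j, X i j • Λ (Matrix.single i j 1) := by
    conv_lhs => rw [Matrix.matrix_eq_sum_single X]
    simp only [map_sum]
    refine Finset.sum_congr rfl fun i _ => Finset.sum_congr rfl fun j _ => ?_
    rw [← map_smul, Matrix.smul_single, smul_eq_mul, mul_one]
  rw [hX, Finset.sum_mul, Matrix.trace_sum]
  conv_rhs => rw [Matrix.trace]
  refine Finset.sum_congr rfl fun i _ => ?_
  rw [Finset.sum_mul, Matrix.trace_sum, Matrix.diag_apply, Matrix.mul_apply]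
  refine Finset.sum_congr rfl fun j _ => ?_
  rw [Matrix.smul_mul, Matrix.trace_smul, smul_eq_mul]
  rfl

theorem eq_dualMap {A A' : Type*} [Fintype A] [Fintype A'] [DecidableEq A]
    (Λ : Matrix A A ℂ →ₗ[ℂ] Matrix A' A' ℂ) (Θ : Matrix A' A' ℂ →ₗ[ℂ] Matrix A A ℂ)
    (h : ∀ X Y, (Λ X * Y).trace = (X * Θ Y).trace) : Θ = dualMap Λ := by
  refine LinearMap.ext fun Y => Matrix.ext_iff_trace_mul_left.mpr fun X => ?_
  rw [← h, trace_map_mul]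

/-- Non-entangling (separable-preserving) maps. -/
def IsNonEntangling {A₁ B₁ A₂ B₂ : Type*}
    (Λ : Matrix (A₁ × B₁) (A₁ × B₁) ℂ →ₗ[ℂ] Matrix (A₂ × B₂) (A₂ × B₂) ℂ) : Prop :=
  IsCompletelyPositive Λ ∧ ∀ σ, IsSeparableOperator σ → IsSeparableOperator (Λ σ)

/-- Dually non-entangling maps. -/
def IsDuallyNonEntangling {A₁ B₁ A₂ B₂ : Type*} [Fintype A₂] [Fintype B₂]
    [DecidableEq A₁] [DecidableEq B₁]
    (Λ : Matrix (A₁ × B₁) (A₁ × B₁) ℂ →ₗ[ℂ] Matrix (A₂ × B₂) (A₂ × B₂) ℂ) : Prop :=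
  IsNonEntangling Λ ∧ IsNonEntangling (dualMap Λ)

/-- `Λ = ∑ j, Φ j ⊗ Ψ j`, tested on product operators, which span all operators. -/
def IsSumOfTensors {A₁ B₁ A₂ B₂ : Type*} {m : ℕ}
    (Λ : Matrix (A₁ × B₁) (A₁ × B₁) ℂ →ₗ[ℂ] Matrix (A₂ × B₂) (A₂ × B₂) ℂ)
    (Φ : Fin m → Matrix A₁ A₁ ℂ →ₗ[ℂ] Matrix A₂ A₂ ℂ)
    (Ψ : Fin m → Matrix B₁ B₁ ℂ →ₗ[ℂ] Matrix B₂ B₂ ℂ) : Prop :=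
  ∀ X Y, Λ (X ⊗ₖ Y) = ∑ j, Φ j X ⊗ₖ Ψ j Y

/-- One-way LOCC channels, communication from `A` to `B`: the first party applies an instrument
`(Φ j)` and announces the outcome `j`; the second party then applies the channel `Ψ j`. -/
def IsOneWayRight {A₁ B₁ A₂ B₂ : Type*} [Fintype A₁] [Fintype B₁] [Fintype A₂] [Fintype B₂]
    (Λ : Matrix (A₁ × B₁) (A₁ × B₁) ℂ →ₗ[ℂ] Matrix (A₂ × B₂) (A₂ × B₂) ℂ) : Prop :=
  ∃ (m : ℕ) (Φ : Fin m → Matrix A₁ A₁ ℂ →ₗ[ℂ] Matrix A₂ A₂ ℂ)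
    (Ψ : Fin m → Matrix B₁ B₁ ℂ →ₗ[ℂ] Matrix B₂ B₂ ℂ),
    (∀ j, IsCompletelyPositive (Φ j)) ∧ IsTracePreserving (∑ j, Φ j) ∧
      (∀ j, IsQuantumChannel (Ψ j)) ∧ IsSumOfTensors Λ Φ Ψ

/-- One-way LOCC channels, communication from `B` to `A`. -/
def IsOneWayLeft {A₁ B₁ A₂ B₂ : Type*} [Fintype A₁] [Fintype B₁] [Fintype A₂] [Fintype B₂]
    (Λ : Matrix (A₁ × B₁) (A₁ × B₁) ℂ →ₗ[ℂ] Matrix (A₂ × B₂) (A₂ × B₂) ℂ) : Prop :=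
  ∃ (m : ℕ) (Φ : Fin m → Matrix A₁ A₁ ℂ →ₗ[ℂ] Matrix A₂ A₂ ℂ)
    (Ψ : Fin m → Matrix B₁ B₁ ℂ →ₗ[ℂ] Matrix B₂ B₂ ℂ),
    (∀ j, IsQuantumChannel (Φ j)) ∧ (∀ j, IsCompletelyPositive (Ψ j)) ∧
      IsTracePreserving (∑ j, Ψ j) ∧ IsSumOfTensors Λ Φ Ψ

/-- LOCC channels: finite compositions of one-way LOCC channels (in either direction), through
arbitrary finite-dimensional intermediate local spaces. These are the channels implemented by
finitely many rounds of local operations and classical communication; memory of earlier outcomes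
is kept in the intermediate local spaces. -/
inductive IsLOCC : {A₁ B₁ A₂ B₂ : Type} → [Fintype A₁] → [Fintype B₁] → [Fintype A₂] →
    [Fintype B₂] →
    (Matrix (A₁ × B₁) (A₁ × B₁) ℂ →ₗ[ℂ] Matrix (A₂ × B₂) (A₂ × B₂) ℂ) → Prop
  | right {A₁ B₁ A₂ B₂ : Type} [Fintype A₁] [Fintype B₁] [Fintype A₂] [Fintype B₂]
      {Λ : Matrix (A₁ × B₁) (A₁ × B₁) ℂ →ₗ[ℂ] Matrix (A₂ × B₂) (A₂ × B₂) ℂ} :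
      IsOneWayRight Λ → IsLOCC Λ
  | left {A₁ B₁ A₂ B₂ : Type} [Fintype A₁] [Fintype B₁] [Fintype A₂] [Fintype B₂]
      {Λ : Matrix (A₁ × B₁) (A₁ × B₁) ℂ →ₗ[ℂ] Matrix (A₂ × B₂) (A₂ × B₂) ℂ} :
      IsOneWayLeft Λ → IsLOCC Λ
  | comp {A₁ B₁ A₂ B₂ A₃ B₃ : Type} [Fintype A₁] [Fintype B₁] [Fintype A₂] [Fintype B₂]
      [Fintype A₃] [Fintype B₃]
      {Λ : Matrix (A₁ × B₁) (A₁ × B₁) ℂ →ₗ[ℂ] Matrix (A₂ × B₂) (A₂ × B₂) ℂ}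
      {Θ : Matrix (A₂ × B₂) (A₂ × B₂) ℂ →ₗ[ℂ] Matrix (A₃ × B₃) (A₃ × B₃) ℂ} :
      IsLOCC Λ → IsLOCC Θ → IsLOCC (Θ ∘ₗ Λ)

/-- `ρ^{⊗ n}`, regarded as an operator on the bipartite space `A^{⊗ n} : B^{⊗ n}`. -/
def tensorPower {A B : Type*} (ρ : Matrix (A × B) (A × B) ℂ) (n : ℕ) :
    Matrix ((Fin n → A) × (Fin n → B)) ((Fin n → A) × (Fin n → B)) ℂ :=
  Matrix.of fun p q => ∏ i, ρ (p.1 i, p.2 i) (q.1 i, q.2 i)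

/-- The two-qubit unit vector `(|00⟩ + |11⟩) / √2`. -/
def phiPlusVec : Fin 2 × Fin 2 → ℂ := fun p => if p.1 = p.2 then ((√2 : ℝ) : ℂ)⁻¹ else 0

/-- The maximally entangled two-qubit state `φ₂⁺`. -/
def phiPlus : Matrix (Fin 2 × Fin 2) (Fin 2 × Fin 2) ℂ :=
  Matrix.vecMulVec phiPlusVec (star phiPlusVec)

/-- Distillability under LOCC: LOCC channels `Λₙ` with `‖Λₙ(ρ^{⊗ n}) - φ₂⁺‖₁ → 0` exist. -/
def IsLOCCDistillable {A B : Type} [Fintype A] [Fintype B] (ρ : Matrix (A × B) (A × B) ℂ) :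
    Prop :=
  ∃ Λ : ∀ n : ℕ,
      Matrix ((Fin n → A) × (Fin n → B)) ((Fin n → A) × (Fin n → B)) ℂ →ₗ[ℂ]
        Matrix (Fin 2 × Fin 2) (Fin 2 × Fin 2) ℂ,
    (∀ n, IsLOCC (Λ n)) ∧
    Filter.Tendsto (fun n => traceNorm (Λ n (tensorPower ρ n) - phiPlus)) Filter.atTop (nhds 0)

end

/-! A witness for `ρ` comes from Hahn–Banach, because the product states have a compact convex hull
(`IsEntangledState.exists_witness`). The identity is interior to the separable cone, so `W` can be
shrunk until `1 + W` and `1 - W` are both separable (`IsEntangledState.exists_small_witness`). Then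
`A = ((1 + W) + 1) / 3` and `1 - A = (1 - W) / 3` are separable.

For separable `σ` with `r = Tr(Wσ) ≥ 0` and `t = Tr σ`, the output is `(r/4) 1 + ((t - r)/6) (1 + 2
φ₂⁺)`, and `1 + 2 φ₂⁺` is separable. The dual exchanges tests and preparations; it preserves
separability because `Tr(φ₂⁺ Y) ≤ Tr(Y) / 2` for separable `Y`. On `ρ`, noise is prepared with
probability `p = (2 + Tr(Wρ)) / 3 < 2/3`, so the fidelity `1 - 3p/4` exceeds `1/2`.

The output is isotropic, with diagonal `a, b, b, a` and coherence `c`, where `0 ≤ b < c ≤ a`. To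
distill it, both parties project blocks of `m * k` copies onto a concatenated repetition code.
Projecting `k` copies onto the span of `|x…x⟩` raises every matrix entry to the power `k`, which
suppresses `b` against `c`. After Hadamard gates, a second power `m` suppresses the phase errors
that the first made worse. This needs `m` large against `(a/c)^k` and small against `(a/b)^k`, a
window that opens as `k` grows since `b < c` (`exists_code_parameters`). A block succeeds with a
fixed positive probability, so many blocks are tried and the first success is kept
(`exists_isLOCC_select`, `exists_isLOCC_fidelity`). -/

noncomputable section

/-! ### Maps in Kraus form -/

/-- The completely positive map with Kraus operators `K i`. -/
def krausMap {ι A C : Type*} [Fintype ι] [Fintype A] (K : ι → Matrix C A ℂ) :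
    Matrix A A ℂ →ₗ[ℂ] Matrix C C ℂ where
  toFun X := ∑ i, K i * X * (K i).conjTranspose
  map_add' X Y := by simp [Matrix.mul_add, Matrix.add_mul, Finset.sum_add_distrib]
  map_smul' c X := by simp [Finset.smul_sum]

theorem krausMap_apply {ι A C : Type*} [Fintype ι] [Fintype A] (K : ι → Matrix C A ℂ)
    (X : Matrix A A ℂ) : krausMap K X = ∑ i, K i * X * (K i).conjTranspose := rfl

theorem krausMap_posSemidef {ι A C : Type*} [Fintype ι] [Fintype A] [Finite C]
    (K : ι → Matrix C A ℂ) {X : Matrix A A ℂ} (hX : X.PosSemidef) :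
    (krausMap K X).PosSemidef := by
  rw [krausMap_apply]
  exact Matrix.posSemidef_sum _ fun i _ => hX.mul_mul_conjTranspose_same (K i)

theorem isCompletelyPositive_krausMap {ι A C : Type*} [Fintype ι] [Fintype A] [Finite C]
    (K : ι → Matrix C A ℂ) : IsCompletelyPositive (krausMap K) := by
  classical
  intro k M hM
  have h : ampliation k (krausMap K) M =
      krausMap (fun i => (1 : Matrix (Fin k) (Fin k) ℂ) ⊗ₖ K i) M := by
    ext ⟨p1, p2⟩ ⟨q1, q2⟩
    simp [ampliation, krausMap_apply, Matrix.sum_apply, Matrix.mul_apply, Fintype.sum_prod_type,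
      Matrix.one_apply, Finset.sum_mul, apply_ite (starRingEnd ℂ)]
  rw [h]
  exact krausMap_posSemidef _ hM

theorem isTracePreserving_krausMap {ι A C : Type*} [Fintype ι] [Fintype A] [DecidableEq A]
    [Fintype C] (K : ι → Matrix C A ℂ) (hK : ∑ i, (K i).conjTranspose * K i = 1) :
    IsTracePreserving (krausMap K) := by
  intro X
  rw [krausMap_apply, Matrix.trace_sum]
  calc ∑ i, (K i * X * (K i).conjTranspose).trace
      = ∑ i, ((K i).conjTranspose * K i * X).trace :=
        Finset.sum_congr rfl fun i _ => by rw [Matrix.trace_mul_comm, Matrix.mul_assoc]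
    _ = X.trace := by rw [← Matrix.trace_sum, ← Finset.sum_mul, hK, one_mul]

theorem isQuantumChannel_krausMap {ι A C : Type*} [Fintype ι] [Fintype A] [DecidableEq A]
    [Fintype C] (K : ι → Matrix C A ℂ) (hK : ∑ i, (K i).conjTranspose * K i = 1) :
    IsQuantumChannel (krausMap K) :=
  ⟨isCompletelyPositive_krausMap K, isTracePreserving_krausMap K hK⟩

/-- This is the shape demanded by `IsSumOfTensors`: the announced outcome `j` is shared, while `l`
is private to the second party and is summed inside its tensor factor. -/
theorem krausMap_kronecker {J ι A₁ B₁ A₂ B₂ : Type*} [Fintype J] [Fintype ι] [Fintype A₁]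
    [Fintype B₁] (K : J → Matrix A₂ A₁ ℂ) (L : J → ι → Matrix B₂ B₁ ℂ)
    (X : Matrix A₁ A₁ ℂ) (Y : Matrix B₁ B₁ ℂ) :
    krausMap (fun p : J × ι => K p.1 ⊗ₖ L p.1 p.2) (X ⊗ₖ Y) =
      ∑ j, krausMap (fun _ : Unit => K j) X ⊗ₖ krausMap (L j) Y := by
  have hr : ∀ (M : Matrix A₂ A₂ ℂ) (N : ι → Matrix B₂ B₂ ℂ),
      ∑ l, M ⊗ₖ N l = M ⊗ₖ ∑ l, N l := by
    intro M N
    ext p q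
    simp [Matrix.sum_apply, Finset.mul_sum]
  simp only [krausMap_apply, Fintype.sum_prod_type, Matrix.conjTranspose_kronecker,
    ← Matrix.mul_kronecker_mul, hr, Finset.univ_unique, Finset.sum_singleton]

theorem krausMap_kronecker' {J ι A₁ B₁ A₂ B₂ : Type*} [Fintype J] [Fintype ι] [Fintype A₁]
    [Fintype B₁] (K : J → ι → Matrix A₂ A₁ ℂ) (L : J → Matrix B₂ B₁ ℂ)
    (X : Matrix A₁ A₁ ℂ) (Y : Matrix B₁ B₁ ℂ) :
    krausMap (fun p : J × ι => K p.1 p.2 ⊗ₖ L p.1) (X ⊗ₖ Y) =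
      ∑ j, krausMap (K j) X ⊗ₖ krausMap (fun _ : Unit => L j) Y := by
  have hr : ∀ (M : ι → Matrix A₂ A₂ ℂ) (N : Matrix B₂ B₂ ℂ),
      ∑ l, M l ⊗ₖ N = (∑ l, M l) ⊗ₖ N := by
    intro M N
    ext p q
    simp [Matrix.sum_apply, Finset.sum_mul]
  simp only [krausMap_apply, Fintype.sum_prod_type, Matrix.conjTranspose_kronecker,
    ← Matrix.mul_kronecker_mul, hr, Finset.univ_unique, Finset.sum_singleton]

theorem isTracePreserving_sum_krausMap {J A C : Type*} [Fintype J] [Fintype A] [DecidableEq A]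
    [Fintype C] (K : J → Matrix C A ℂ) (hK : ∑ j, (K j).conjTranspose * K j = 1) :
    IsTracePreserving (∑ j : Fin (Fintype.card J),
      krausMap (fun _ : Unit => K ((Fintype.equivFin J).symm j))) := by
  have h : (∑ j : Fin (Fintype.card J),
      krausMap (fun _ : Unit => K ((Fintype.equivFin J).symm j))) = krausMap K := by
    ext1 X
    rw [(Fintype.equivFin J).symm.sum_comp fun j => krausMap (fun _ : Unit => K j)]
    simp [krausMap_apply]
  rw [h]
  exact isTracePreserving_krausMap K hK

/-- The first party measures with Kraus operators `K j`, the second party then applies the channel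
with Kraus operators `L j l`. -/
theorem isLOCC_krausMap_right {J ι : Type*} {A₁ B₁ A₂ B₂ : Type} [Fintype J] [Fintype ι]
    [Fintype A₁] [Fintype B₁] [Fintype A₂] [Fintype B₂] [DecidableEq A₁] [DecidableEq B₁]
    (K : J → Matrix A₂ A₁ ℂ) (L : J → ι → Matrix B₂ B₁ ℂ)
    (hK : ∑ j, (K j).conjTranspose * K j = 1)
    (hL : ∀ j, ∑ l, (L j l).conjTranspose * L j l = 1) :
    IsLOCC (krausMap (fun p : J × ι => K p.1 ⊗ₖ L p.1 p.2)) := by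
  refine .right ⟨Fintype.card J,
    fun j => krausMap fun _ : Unit => K ((Fintype.equivFin J).symm j),
    fun j => krausMap (L ((Fintype.equivFin J).symm j)),
    fun j => isCompletelyPositive_krausMap _, isTracePreserving_sum_krausMap K hK,
    fun j => isQuantumChannel_krausMap _ (hL _), fun X Y => ?_⟩
  rw [krausMap_kronecker, ← (Fintype.equivFin J).symm.sum_comp]

/-- The second party measures with Kraus operators `L j`, the first party then applies the channel
with Kraus operators `K j l`. -/
theorem isLOCC_krausMap_left {J ι : Type*} {A₁ B₁ A₂ B₂ : Type} [Fintype J] [Fintype ι]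
    [Fintype A₁] [Fintype B₁] [Fintype A₂] [Fintype B₂] [DecidableEq A₁] [DecidableEq B₁]
    (K : J → ι → Matrix A₂ A₁ ℂ) (L : J → Matrix B₂ B₁ ℂ)
    (hK : ∀ j, ∑ l, (K j l).conjTranspose * K j l = 1)
    (hL : ∑ j, (L j).conjTranspose * L j = 1) :
    IsLOCC (krausMap (fun p : J × ι => K p.1 p.2 ⊗ₖ L p.1)) := by
  refine .left ⟨Fintype.card J,
    fun j => krausMap (K ((Fintype.equivFin J).symm j)),
    fun j => krausMap fun _ : Unit => L ((Fintype.equivFin J).symm j),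
    fun j => isQuantumChannel_krausMap _ (hK _), fun j => isCompletelyPositive_krausMap _,
    isTracePreserving_sum_krausMap L hL, fun X Y => ?_⟩
  rw [krausMap_kronecker', ← (Fintype.equivFin J).symm.sum_comp]

/-! ### Maps relabelling basis vectors -/

/-- The Kraus operators of the isometry `|a⟩ ↦ |F a⟩` followed by the partial trace over `R`. -/
def basisKraus {A C R : Type*} [DecidableEq C] [DecidableEq R] (F : A → C × R) (r : R) :
    Matrix C A ℂ :=
  Matrix.of fun c a => if F a = (c, r) then 1 else 0

theorem sum_basisKraus {A C R : Type*} [DecidableEq C] [DecidableEq R] [Fintype C]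
    [Fintype R] [DecidableEq A] (F : A → C × R) (hF : Function.Injective F) :
    ∑ r, (basisKraus F r).conjTranspose * basisKraus F r = 1 := by
  ext a b
  simp only [Matrix.sum_apply, Matrix.mul_apply, Matrix.conjTranspose_apply, basisKraus,
    Matrix.of_apply, apply_ite star, star_one, star_zero, ite_mul, one_mul, zero_mul,
    Matrix.one_apply]
  rw [Finset.sum_comm, ← Fintype.sum_prod_type' (f := fun c r =>
    if F a = (c, r) then (if F b = (c, r) then (1 : ℂ) else 0) else 0)]
  simp [hF.eq_iff, eq_comm]

/-- The adjoint pulls vectors back along `F`, so a fidelity after relabelling is a sum of quadratic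
forms of the original operator at explicit vectors. -/
theorem conjTranspose_basisKraus_mulVec {A C R : Type*} [DecidableEq C] [DecidableEq R]
    [Fintype C] (F : A → C × R) (r : R) (w : C → ℂ) (a : A) :
    ((basisKraus F r).conjTranspose.mulVec w) a = if (F a).2 = r then w (F a).1 else 0 := by
  obtain ⟨⟨c, r'⟩, h⟩ : ∃ z, F a = z := ⟨_, rfl⟩
  simp [Matrix.mulVec, dotProduct, basisKraus, h, ite_and]
  split_ifs <;> simp

theorem basisKraus_kronecker {A C R B D S : Type*} [DecidableEq C] [DecidableEq R]
    [DecidableEq D] [DecidableEq S] (F : A → C × R) (G : B → D × S) (r : R) (s : S) :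
    basisKraus F r ⊗ₖ basisKraus G s =
      basisKraus (fun p : A × B => (((F p.1).1, (G p.2).1), ((F p.1).2, (G p.2).2))) (r, s) := by
  ext ⟨c, d⟩ ⟨a, b⟩
  simp only [basisKraus, Matrix.kroneckerMap_apply, Matrix.of_apply, Prod.ext_iff, ← ite_and,
    mul_ite, mul_one, mul_zero]
  refine if_congr ?_ rfl rfl
  tauto

/-! ### Fidelities -/

/-- The quadratic form `⟨v, X v⟩`. -/
def expectation {A : Type*} [Fintype A] (X : Matrix A A ℂ) (v : A → ℂ) : ℂ :=
  star v ⬝ᵥ X.mulVec v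

theorem expectation_krausMap {ι A C : Type*} [Fintype ι] [Fintype A] [Fintype C]
    (K : ι → Matrix C A ℂ) (X : Matrix A A ℂ) (v : C → ℂ) :
    expectation (krausMap K X) v = ∑ i, expectation X ((K i).conjTranspose.mulVec v) := by
  simp only [expectation, krausMap_apply, Matrix.sum_mulVec, dotProduct_sum]
  refine Finset.sum_congr rfl fun i _ => ?_
  rw [← Matrix.mulVec_mulVec, ← Matrix.mulVec_mulVec, Matrix.star_mulVec,
    Matrix.conjTranspose_conjTranspose, Matrix.dotProduct_mulVec]

theorem expectation_nonneg {A : Type*} [Fintype A] {X : Matrix A A ℂ} (hX : X.PosSemidef)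
    (v : A → ℂ) : 0 ≤ expectation X v :=
  hX.dotProduct_mulVec_nonneg v

theorem expectation_phiPlusVec (X : Matrix (Fin 2 × Fin 2) (Fin 2 × Fin 2) ℂ) :
    expectation X phiPlusVec = (X * phiPlus).trace := by
  rw [phiPlus, Matrix.mul_vecMulVec, Matrix.trace_vecMulVec, expectation, dotProduct_comm]

/-! ### The trace norm -/

/-- Cauchy–Schwarz for the singular values against the constant vector. -/
theorem traceNorm_le_sqrt {A : Type*} [Fintype A] [DecidableEq A] (X : Matrix A A ℂ) :
    traceNorm X ≤ √(Fintype.card A) * √((X.conjTranspose * X).trace.re) := by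
  have hps := Matrix.posSemidef_conjTranspose_mul_self X
  have htr : (X.conjTranspose * X).trace.re =
      ∑ i, (Matrix.isHermitian_conjTranspose_mul_self X).eigenvalues i := by
    rw [(Matrix.isHermitian_conjTranspose_mul_self X).trace_eq_sum_eigenvalues]
    simp
  rw [htr, traceNorm]
  have h := Real.sum_sqrt_mul_sqrt_le (Finset.univ : Finset A) (f := fun _ => (1 : ℝ))
    (g := (Matrix.isHermitian_conjTranspose_mul_self X).eigenvalues)
    (fun _ => zero_le_one) (fun i => hps.eigenvalues_nonneg i)
  simpa using h

/-- The principal minor on `i, j` is nonnegative. -/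
theorem Matrix.PosSemidef.norm_apply_sq_le {A : Type*} [Fintype A] {X : Matrix A A ℂ}
    (hX : X.PosSemidef) (i j : A) : ‖X i j‖ ^ 2 ≤ (X i i).re * (X j j).re := by
  have h := (hX.submatrix ![i, j]).det_nonneg
  rw [Matrix.det_fin_two] at h
  have hji : X j i = star (X i j) := (hX.1.apply j i).symm
  have him : ∀ i, (X i i).im = 0 := fun i => by
    have := hX.1.apply i i
    exact Complex.conj_eq_iff_im.mp this
  have h2 := (Complex.le_def.mp h).1
  simp only [Matrix.submatrix_apply, Matrix.cons_val_zero, Matrix.cons_val_one, hji,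
    Complex.star_def, Complex.mul_conj, Complex.sub_re, Complex.mul_re, him, Complex.zero_re,
    Complex.ofReal_re, mul_zero, sub_zero] at h2
  rw [← Complex.normSq_eq_norm_sq]
  linarith

theorem Matrix.PosSemidef.trace_mul_self_le {A : Type*} [Fintype A] {X : Matrix A A ℂ}
    (hX : X.PosSemidef) : (X * X).trace.re ≤ X.trace.re ^ 2 := by
  have h : (X * X).trace.re = ∑ i, ∑ j, ‖X i j‖ ^ 2 := by
    simp only [Matrix.trace, Matrix.diag_apply, Matrix.mul_apply, Complex.re_sum]
    refine Finset.sum_congr rfl fun i _ => Finset.sum_congr rfl fun j _ => ?_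
    rw [← hX.1.apply j i, Complex.star_def, Complex.mul_conj, Complex.ofReal_re,
      Complex.normSq_eq_norm_sq]
  rw [h, sq, Matrix.trace, Complex.re_sum, Finset.sum_mul_sum]
  exact Finset.sum_le_sum fun i _ => Finset.sum_le_sum fun j _ => hX.norm_apply_sq_le i j

theorem trace_phiPlus : phiPlus.trace = 1 := by
  have h : ((√2 : ℝ) : ℂ)⁻¹ * ((√2 : ℝ) : ℂ)⁻¹ = 1 / 2 := by
    rw [← mul_inv, ← Complex.ofReal_mul, Real.mul_self_sqrt zero_le_two]; norm_num
  simp [phiPlus, Matrix.trace, Matrix.vecMulVec_apply, phiPlusVec, Fintype.sum_prod_type, h,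
    Complex.conj_ofReal]

theorem posSemidef_phiPlus : phiPlus.PosSemidef :=
  Matrix.posSemidef_vecMulVec_self_star _

theorem phiPlus_mul_self : phiPlus * phiPlus = phiPlus := by
  have h := trace_phiPlus
  rw [phiPlus, Matrix.trace_vecMulVec] at h
  rw [phiPlus, Matrix.vecMulVec_mul_vecMulVec, dotProduct_comm, h]
  simp

/-- The trace distance to `φ₂⁺` is controlled by the fidelity. -/
theorem traceNorm_sub_phiPlus_le {X : Matrix (Fin 2 × Fin 2) (Fin 2 × Fin 2) ℂ} (hX : IsState X) :
    traceNorm (X - phiPlus) ≤ 2 * √(2 * (1 - (expectation X phiPlusVec).re)) := by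
  refine (traceNorm_le_sqrt _).trans ?_
  have h4 : √(Fintype.card (Fin 2 × Fin 2) : ℝ) = 2 := by
    rw [Real.sqrt_eq_iff_mul_self_eq] <;> norm_num
  rw [h4]
  refine mul_le_mul_of_nonneg_left (Real.sqrt_le_sqrt ?_) zero_le_two
  -- The squared Frobenius distance is `Tr X² - 2F + 1` with `F` the fidelity, and `Tr X² ≤ (Tr X)²
  -- = 1`.
  have h1 := hX.1.trace_mul_self_le
  rw [hX.2] at h1
  rw [expectation_phiPlusVec, Matrix.conjTranspose_sub, hX.1.1.eq, posSemidef_phiPlus.1.eq,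
    Matrix.sub_mul, Matrix.mul_sub, Matrix.mul_sub, phiPlus_mul_self]
  simp only [Matrix.trace_sub, trace_phiPlus, Matrix.trace_mul_comm phiPlus X, Complex.sub_re]
  simp only [Complex.one_re] at h1 ⊢
  linarith

/-! ### Tensor powers -/

/-- The sesquilinear form `⟨u, X v⟩`. -/
def sesqForm {A : Type*} [Fintype A] (X : Matrix A A ℂ) (u v : A → ℂ) : ℂ :=
  star u ⬝ᵥ X.mulVec v

theorem sesqForm_eq_sum {A : Type*} [Fintype A] (X : Matrix A A ℂ) (u v : A → ℂ) :
    sesqForm X u v = ∑ p, ∑ q, star (u p) * X p q * v q := by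
  simp [sesqForm, dotProduct, Matrix.mulVec, Finset.mul_sum, mul_assoc]

theorem sesqForm_single {A : Type*} [Fintype A] [DecidableEq A] (X : Matrix A A ℂ) (a b : A) :
    sesqForm X (Pi.single a 1) (Pi.single b 1) = X a b := by
  simp [sesqForm]

theorem mul_mul_conjTranspose_apply {A C : Type*} [Fintype A] (K : Matrix C A ℂ)
    (X : Matrix A A ℂ) (c d : C) :
    (K * X * K.conjTranspose) c d = sesqForm X (star (K c)) (star (K d)) := by
  rw [sesqForm_eq_sum, Matrix.mul_apply]
  simp only [Matrix.mul_apply, Finset.sum_mul, Matrix.conjTranspose_apply, Pi.star_apply, star_star]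
  exact Finset.sum_comm

/-- `ρ^{⊗ ι}` for a finite index type `ι`, as an operator on `A^{⊗ ι} : B^{⊗ ι}`. -/
def tensorPow (ι : Type*) [Fintype ι] {A B : Type*} (ρ : Matrix (A × B) (A × B) ℂ) :
    Matrix ((ι → A) × (ι → B)) ((ι → A) × (ι → B)) ℂ :=
  Matrix.of fun p q => ∏ i, ρ (p.1 i, p.2 i) (q.1 i, q.2 i)

theorem tensorPower_eq_tensorPow {A B : Type*} (ρ : Matrix (A × B) (A × B) ℂ) (n : ℕ) :
    tensorPower ρ n = tensorPow (Fin n) ρ := rfl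

/-- The product vector with factors `v i`. -/
def prodVec {ι : Type*} [Fintype ι] {A B : Type*} (v : ι → A × B → ℂ) :
    (ι → A) × (ι → B) → ℂ :=
  fun p => ∏ i, v i (p.1 i, p.2 i)

/-- Distributivity, with pairs of strings read as strings of pairs; most factorisations over copies
rest on it. -/
theorem sum_prod_arrow {ι A B : Type*} [Fintype ι] [DecidableEq ι] [Fintype A] [Fintype B]
    (f : ι → A × B → ℂ) :
    ∑ p : (ι → A) × (ι → B), ∏ i, f i (p.1 i, p.2 i) = ∏ i, ∑ q, f i q := by
  rw [Finset.prod_univ_sum, Fintype.piFinset_univ]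
  exact (Equiv.sum_comp (Equiv.arrowProdEquivProdArrow ι (fun _ => A) (fun _ => B)).symm
    fun u => ∏ i, f i (u i))

theorem sesqForm_tensorPow {ι A B : Type*} [Fintype ι] [DecidableEq ι] [Fintype A] [Fintype B]
    (ρ : Matrix (A × B) (A × B) ℂ) (u v : ι → A × B → ℂ) :
    sesqForm (tensorPow ι ρ) (prodVec u) (prodVec v) = ∏ i, sesqForm ρ (u i) (v i) := by
  simp only [sesqForm_eq_sum, prodVec, tensorPow, Matrix.of_apply, star_prod,
    ← Finset.prod_mul_distrib]
  rw [← sum_prod_arrow fun i p => ∑ q, star (u i p) * ρ p q * v i q]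
  refine Finset.sum_congr rfl fun p _ => ?_
  exact sum_prod_arrow fun i q => star (u i (p.1 i, p.2 i)) * ρ (p.1 i, p.2 i) q * v i q

theorem trace_tensorPow {ι A B : Type*} [Fintype ι] [DecidableEq ι] [Fintype A] [Fintype B]
    (ρ : Matrix (A × B) (A × B) ℂ) : (tensorPow ι ρ).trace = ρ.trace ^ Fintype.card ι := by
  simp only [Matrix.trace, Matrix.diag_apply, tensorPow, Matrix.of_apply]
  rw [sum_prod_arrow fun _ q => ρ q q, Finset.prod_const, Finset.card_univ]

/-- The tensor power of a Kraus family. -/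
def tensorKraus (ι : Type*) [Fintype ι] {Z A C : Type*} (K : Z → Matrix C A ℂ) (z : ι → Z) :
    Matrix (ι → C) (ι → A) ℂ :=
  Matrix.of fun c a => ∏ i, K (z i) (c i) (a i)

theorem sum_tensorKraus {ι Z A C : Type*} [Fintype ι] [DecidableEq ι] [Fintype Z] [Fintype A]
    [DecidableEq A] [Fintype C] (K : Z → Matrix C A ℂ)
    (hK : ∑ z, (K z).conjTranspose * K z = 1) :
    ∑ z, (tensorKraus ι K z).conjTranspose * tensorKraus ι K z = 1 := by
  ext a b
  have h : ∀ i, ∑ q : Z × C, star (K q.1 q.2 (a i)) * K q.1 q.2 (b i) =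
      (1 : Matrix A A ℂ) (a i) (b i) := fun i => by
    rw [← hK, Fintype.sum_prod_type]
    simp [Matrix.sum_apply, Matrix.mul_apply]
  have h2 := sum_prod_arrow fun i (q : Z × C) => star (K q.1 q.2 (a i)) * K q.1 q.2 (b i)
  rw [Fintype.sum_prod_type] at h2
  simp only [Matrix.sum_apply, Matrix.mul_apply, Matrix.conjTranspose_apply, tensorKraus,
    Matrix.of_apply, star_prod, ← Finset.prod_mul_distrib]
  rw [h2]
  simp only [h, Matrix.one_apply, Finset.prod_ite_zero, Finset.prod_const_one, funext_iff,
    Finset.mem_univ, true_implies]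

/-- Entries of `K X K†` are sesquilinear forms of `X` at conjugated rows of `K`. The rows here are
product vectors, so the forms factor over the copies. -/
theorem krausMap_tensorPow {ι Y Z A B C D : Type*} [Fintype ι] [DecidableEq ι] [Fintype Y]
    [Fintype Z] [Fintype A] [Fintype B] (K : Y → Matrix C A ℂ) (L : Z → Matrix D B ℂ)
    (ρ : Matrix (A × B) (A × B) ℂ) :
    krausMap (fun z : (ι → Y) × (ι → Z) => tensorKraus ι K z.1 ⊗ₖ tensorKraus ι L z.2)
      (tensorPow ι ρ) = tensorPow ι (krausMap (fun z : Y × Z => K z.1 ⊗ₖ L z.2) ρ) := by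
  ext p q
  simp only [krausMap_apply, Matrix.sum_apply, mul_mul_conjTranspose_apply]
  have h : ∀ (z : (ι → Y) × (ι → Z)) (p : (ι → C) × (ι → D)),
      star ((tensorKraus ι K z.1 ⊗ₖ tensorKraus ι L z.2) p) =
        prodVec fun i => star ((K (z.1 i) ⊗ₖ L (z.2 i)) (p.1 i, p.2 i)) := by
    intro z p
    ext s
    simp [prodVec, tensorKraus, Matrix.kroneckerMap_apply, Finset.prod_mul_distrib]
  simp only [h, sesqForm_tensorPow]
  rw [sum_prod_arrow fun i (z : Y × Z) => sesqForm ρ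
    (star ((K z.1 ⊗ₖ L z.2) (p.1 i, p.2 i))) (star ((K z.1 ⊗ₖ L z.2) (q.1 i, q.2 i)))]
  simp [tensorPow, Matrix.sum_apply, mul_mul_conjTranspose_apply]

/-- Local channels are LOCC. -/
theorem isLOCC_krausMap_local {Y Z : Type*} {A₁ B₁ A₂ B₂ : Type} [Fintype Y] [Fintype Z]
    [Fintype A₁] [Fintype B₁] [Fintype A₂] [Fintype B₂] [DecidableEq A₁] [DecidableEq B₁]
    (K : Y → Matrix A₂ A₁ ℂ) (L : Z → Matrix B₂ B₁ ℂ)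
    (hK : ∑ j, (K j).conjTranspose * K j = 1)
    (hL : ∑ l, (L l).conjTranspose * L l = 1) :
    IsLOCC (krausMap (fun p : Y × Z => K p.1 ⊗ₖ L p.2)) :=
  isLOCC_krausMap_right K (fun _ => L) hK fun _ => hL

theorem krausMap_basisKraus_equiv {A C R : Type*} [Fintype A] [DecidableEq A] [DecidableEq C]
    [DecidableEq R] [Fintype R] (F : A ≃ C × R) (X : Matrix A A ℂ) (c d : C) :
    krausMap (basisKraus F) X c d = ∑ r, X (F.symm (c, r)) (F.symm (d, r)) := by
  have h : ∀ c r, star (basisKraus F r c) = Pi.single (F.symm (c, r)) 1 := by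
    intro c r
    ext a
    simp [basisKraus, Pi.single_apply, Equiv.eq_symm_apply, apply_ite (starRingEnd ℂ)]
  simp only [krausMap_apply, Matrix.sum_apply, mul_mul_conjTranspose_apply, h, sesqForm_single]

/-- Grouping the copies of a state into blocks, and discarding the others. -/
theorem exists_isLOCC_regroup {ι κ μ ν : Type} [Fintype ι] [Fintype κ] [Fintype μ] [Fintype ν]
    [DecidableEq ι] [DecidableEq κ] [DecidableEq μ] [DecidableEq ν] {A B : Type} [Fintype A]
    [Fintype B] [DecidableEq A] [DecidableEq B] (e : ι ≃ (κ × μ) ⊕ ν)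
    (ρ : Matrix (A × B) (A × B) ℂ) (hρ : ρ.trace = 1) :
    ∃ Λ, IsLOCC Λ ∧ Λ (tensorPow ι ρ) = tensorPow κ (tensorPow μ ρ) := by
  let F (A : Type) : (ι → A) ≃ (κ → μ → A) × (ν → A) :=
    (e.arrowCongr (Equiv.refl A)).trans
      ((Equiv.sumArrowEquivProdArrow (κ × μ) ν A).trans
        ((Equiv.curry κ μ A).prodCongr (Equiv.refl _)))
  have hF1 : ∀ (A : Type) s r i j, (F A).symm (s, r) (e.symm (.inl (i, j))) = s i j := by
    intro A s r i j
    obtain ⟨z, hz⟩ := (F A).surjective (s, r)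
    rw [← hz, Equiv.symm_apply_apply, ← show (F A z).1 = s from congrArg Prod.fst hz]
    rfl
  have hF2 : ∀ (A : Type) s r v, (F A).symm (s, r) (e.symm (.inr v)) = r v := by
    intro A s r v
    obtain ⟨z, hz⟩ := (F A).surjective (s, r)
    rw [← hz, Equiv.symm_apply_apply, ← show (F A z).2 = r from congrArg Prod.snd hz]
    rfl
  refine ⟨_, isLOCC_krausMap_local _ _ (sum_basisKraus (F A) (F A).injective)
    (sum_basisKraus (F B) (F B).injective), ?_⟩
  ext c d
  simp only [basisKraus_kronecker]
  -- The two local relabellings combine into `G`, so the channel is a partial trace over the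
  -- discarded copies, each of which contributes `Tr ρ = 1`.
  let G : (ι → A) × (ι → B) ≃ ((κ → μ → A) × (κ → μ → B)) × ((ν → A) × (ν → B)) :=
    ((F A).prodCongr (F B)).trans (Equiv.prodProdProdComm _ _ _ _)
  have h1 := krausMap_basisKraus_equiv G (tensorPow ι ρ) c d
  refine (show _ = _ from ?_).trans h1 |>.trans ?_
  · rfl
  have hG : ∀ c r, G.symm (c, r) = ((F A).symm (c.1, r.1), (F B).symm (c.2, r.2)) :=
    fun _ _ => rfl
  have h2 : ∀ f : ι → ℂ, ∏ i, f i =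
      (∏ i, ∏ j, f (e.symm (.inl (i, j)))) * ∏ v, f (e.symm (.inr v)) := by
    intro f
    rw [← e.symm.prod_comp, Fintype.prod_sum_type, Fintype.prod_prod_type]
  simp only [tensorPow, Matrix.of_apply, hG, h2, hF1, hF2]
  rw [← Finset.mul_sum, sum_prod_arrow fun _ p => ρ p p]
  rw [show ∑ q, ρ q q = ρ.trace from rfl, hρ]
  simp

/-! ### Selecting a successful pair -/

theorem isState_krausMap {ι A C : Type*} [Fintype ι] [Fintype A] [DecidableEq A]
    [Fintype C] {K : ι → Matrix C A ℂ} (hK : ∑ i, (K i).conjTranspose * K i = 1)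
    {X : Matrix A A ℂ} (hX : IsState X) : IsState (krausMap K X) :=
  ⟨krausMap_posSemidef K hX.1, (isTracePreserving_krausMap K hK X).trans hX.2⟩

theorem sum_kronecker_right {J ι A₁ B₁ A₂ B₂ : Type*} [Fintype J] [Fintype ι] [Fintype A₂]
    [Fintype B₂] [DecidableEq A₁] [DecidableEq B₁] {K : J → Matrix A₂ A₁ ℂ}
    {L : J → ι → Matrix B₂ B₁ ℂ} (hK : ∑ j, (K j).conjTranspose * K j = 1)
    (hL : ∀ j, ∑ l, (L j l).conjTranspose * L j l = 1) :
    ∑ p : J × ι, (K p.1 ⊗ₖ L p.1 p.2).conjTranspose * (K p.1 ⊗ₖ L p.1 p.2) = 1 := by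
  have hr : ∀ (M : Matrix A₁ A₁ ℂ) (N : ι → Matrix B₁ B₁ ℂ), ∑ l, M ⊗ₖ N l = M ⊗ₖ ∑ l, N l := by
    intro M N
    ext p q
    simp [Matrix.sum_apply, Finset.mul_sum]
  have hl : ∀ (M : J → Matrix A₁ A₁ ℂ) (N : Matrix B₁ B₁ ℂ), ∑ l, M l ⊗ₖ N = (∑ l, M l) ⊗ₖ N := by
    intro M N
    ext p q
    simp [Matrix.sum_apply, Finset.sum_mul]
  simp only [Matrix.conjTranspose_kronecker, ← Matrix.mul_kronecker_mul, Fintype.sum_prod_type,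
    hr, hL, hl, hK, Matrix.one_kronecker_one]

theorem sum_kronecker_left {J ι A₁ B₁ A₂ B₂ : Type*} [Fintype J] [Fintype ι] [Fintype A₂]
    [Fintype B₂] [DecidableEq A₁] [DecidableEq B₁] {K : J → ι → Matrix A₂ A₁ ℂ}
    {L : J → Matrix B₂ B₁ ℂ} (hK : ∀ j, ∑ l, (K j l).conjTranspose * K j l = 1)
    (hL : ∑ j, (L j).conjTranspose * L j = 1) :
    ∑ p : J × ι, (K p.1 p.2 ⊗ₖ L p.1).conjTranspose * (K p.1 p.2 ⊗ₖ L p.1) = 1 := by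
  have hl : ∀ (M : ι → Matrix A₁ A₁ ℂ) (N : Matrix B₁ B₁ ℂ), ∑ l, M l ⊗ₖ N = (∑ l, M l) ⊗ₖ N := by
    intro M N
    ext p q
    simp [Matrix.sum_apply, Finset.sum_mul]
  have hr : ∀ (M : Matrix A₁ A₁ ℂ) (N : J → Matrix B₁ B₁ ℂ), ∑ l, M ⊗ₖ N l = M ⊗ₖ ∑ l, N l := by
    intro M N
    ext p q
    simp [Matrix.sum_apply, Finset.mul_sum]
  simp only [Matrix.conjTranspose_kronecker, ← Matrix.mul_kronecker_mul, Fintype.sum_prod_type,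
    hr, hL, hl, hK, Matrix.one_kronecker_one]

theorem expectation_tensorPow_prodVec {ι A B : Type*} [Fintype ι] [DecidableEq ι] [Fintype A]
    [Fintype B] (ρ : Matrix (A × B) (A × B) ℂ) (v : ι → A × B → ℂ) :
    expectation (tensorPow ι ρ) (prodVec v) = ∏ i, expectation ρ (v i) :=
  sesqForm_tensorPow ρ v v

/-- A vector of two qubits, extended by zero to flagged qubits. -/
def flagExtend (w : Fin 2 × Fin 2 → ℂ) (q : Option (Fin 2) × Option (Fin 2)) : ℂ :=
  if q.1.isSome ∧ q.2.isSome then w (q.1.getD 0, q.2.getD 0) else 0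

/-- Which of the flagged qubits are present. -/
def flags {M : ℕ} (s : Fin M → Option (Fin 2)) : Fin M → Bool := fun j => (s j).isSome

/-- Erase the value, but not the flag, of the `i`-th flagged qubit. -/
def blank {M : ℕ} (i : Fin M) (s : Fin M → Option (Fin 2)) : Fin M → Option (Fin 2) :=
  Function.update s i ((s i).map fun _ => 0)

/-- Extract the `i`-th flagged qubit. -/
def pick {M : ℕ} (i : Fin M) (s : Fin M → Option (Fin 2)) : Fin 2 × (Fin M → Option (Fin 2)) :=
  ((s i).getD 0, blank i s)

/-- An absent qubit and a present `0` both read as `0`, but the flag surviving in the blanked string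
tells them apart. -/
theorem pick_injective {M : ℕ} (i : Fin M) : Function.Injective (pick i) := by
  intro s t h
  have h1 : (s i).getD 0 = (t i).getD 0 := congrArg Prod.fst h
  have h2 : blank i s = blank i t := congrArg Prod.snd h
  ext1 j
  have h3 := congrFun h2 j
  rcases eq_or_ne j i with rfl | hj
  · simp only [blank, Function.update_self] at h3
    cases hs : s j <;> cases ht : t j <;> simp_all
  · simpa [blank, hj] using h3

/-- The rule returns the first position flagged on both sides, computed from one party's flags and
the other's string. Its value `0` when there is none is a filler, possible because `M ≠ 0`. -/
theorem exists_select (M : ℕ) [NeZero M] :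
    ∃ sel : (Fin M → Bool) → (Fin M → Option (Fin 2)) → Fin M,
      ∀ c t i, c i = true → (t i).isSome = true →
        (∀ j < i, ¬(c j = true ∧ (t j).isSome = true)) → sel c t = i := by
  classical
  refine ⟨fun c t => if h : ∃ i, (c i = true ∧ (t i).isSome = true) ∧
    ∀ j < i, ¬(c j = true ∧ (t j).isSome = true) then h.choose else 0, fun c t i h1 h2 h3 => ?_⟩
  have h : ∃ i, (c i = true ∧ (t i).isSome = true) ∧
    ∀ j < i, ¬(c j = true ∧ (t j).isSome = true) := ⟨i, ⟨h1, h2⟩, h3⟩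
  simp only [dif_pos h]
  rcases lt_trichotomy h.choose i with hlt | heq | hgt
  · exact absurd h.choose_spec.1 (h3 _ hlt)
  · exact heq
  · exact absurd ⟨h1, h2⟩ (h.choose_spec.2 _ hgt)

theorem blank_eq_iff {M : ℕ} {i : Fin M} {s u : Fin M → Option (Fin 2)} (hu : u i = some 0) :
    blank i s = u ↔ (s i).isSome = true ∧ ∀ j ≠ i, s j = u j := by
  constructor
  · rintro rfl
    refine ⟨?_, fun j hj => by simp [blank, hj]⟩
    simp only [blank, Function.update_self] at hu
    cases hs : s i <;> simp_all
  · rintro ⟨h1, h2⟩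
    ext1 j
    rcases eq_or_ne j i with rfl | hj
    · obtain ⟨x, hx⟩ := Option.isSome_iff_exists.mp h1
      simp [blank, hx, hu]
    · simp [blank, hj, h2]

theorem prodVec_ite_apply {M : ℕ} (i : Fin M) (u : Fin M → Option (Fin 2) × Option (Fin 2))
    (w : Fin 2 × Fin 2 → ℂ) (s t : Fin M → Option (Fin 2)) :
    prodVec (fun j => if j = i then flagExtend w else Pi.single (u j) 1) (s, t) =
      if ((s i).isSome = true ∧ (t i).isSome = true) ∧ ∀ j ≠ i, s j = (u j).1 ∧ t j = (u j).2 then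
        w ((s i).getD 0, (t i).getD 0) else 0 := by
  rw [prodVec]
  split_ifs with h
  · rw [Finset.prod_eq_single i]
    · simp [flagExtend, h.1.1, h.1.2]
    · intro j _ hj
      simp [hj, h.2 j hj]
    · simp
  · by_cases h1 : (s i).isSome = true ∧ (t i).isSome = true
    · have h2 : ∃ j, j ≠ i ∧ ¬(s j = (u j).1 ∧ t j = (u j).2) := by
        by_contra h3
        push Not at h3
        exact h ⟨h1, fun j hj => h3 j hj⟩
      obtain ⟨j, hj, h3⟩ := h2
      refine Finset.prod_eq_zero (Finset.mem_univ j) ?_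
      rw [if_neg hj, Pi.single_eq_of_ne]
      rwa [Ne, Prod.ext_iff]
    · refine Finset.prod_eq_zero (Finset.mem_univ i) ?_
      rw [if_pos rfl, flagExtend, if_neg h1]

/-- The sum factors over positions: each one before `i` must fail and gives `1 - p`, position `i`
gives `g` through its only blanked record, and each later one is unconstrained and gives the trace
`1`. -/
theorem sum_prod_first_success {M : ℕ} (σ : Matrix (Option (Fin 2) × Option (Fin 2))
    (Option (Fin 2) × Option (Fin 2)) ℂ) (hσ : σ.trace = 1) (g : ℂ) (i : Fin M) :
    ∑ u : (Fin M → Option (Fin 2)) × (Fin M → Option (Fin 2)), ∏ j,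
      (if j = i then (if (u.1 j, u.2 j) = (some 0, some 0) then g else 0)
        else if j < i ∧ (u.1 j).isSome ∧ (u.2 j).isSome then 0 else
          σ (u.1 j, u.2 j) (u.1 j, u.2 j)) =
      (1 - ∑ x : Fin 2 × Fin 2, σ (some x.1, some x.2) (some x.1, some x.2)) ^ (i : ℕ) * g := by
  rw [sum_prod_arrow fun j q => (if j = i then (if q = (some 0, some 0) then g else 0)
        else if j < i ∧ q.1.isSome ∧ q.2.isSome then 0 else σ q q)]
  set p := ∑ x : Fin 2 × Fin 2, σ (some x.1, some x.2) (some x.1, some x.2) with hp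
  have h : ∀ j, (∑ q : Option (Fin 2) × Option (Fin 2),
      (if j = i then (if q = (some 0, some 0) then g else 0)
        else if j < i ∧ q.1.isSome ∧ q.2.isSome then 0 else σ q q)) =
      (if j < i then 1 - p else 1) * (if j = i then g else 1) := by
    intro j
    rcases lt_trichotomy j i with hlt | heq | hgt
    · simp only [hlt, hlt.ne, if_false, if_true, true_and, mul_one]
      rw [← hσ, eq_sub_iff_add_eq, hp, Matrix.trace]
      simp [Fintype.sum_prod_type, Fintype.sum_option, Matrix.diag_apply]
      ring
    · subst heq
      simp
    · simp only [hgt.not_gt, hgt.ne', if_false, false_and, mul_one]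
      exact hσ
  simp only [h, Finset.prod_mul_distrib, Finset.prod_ite_eq', Finset.mem_univ, if_true]
  rw [Finset.prod_ite, Finset.prod_const, Finset.prod_const_one, mul_one,
    show Finset.univ.filter (· < i) = Finset.Iio i by ext; simp, Fin.card_Iio]

/-- From `M` flagged pairs, one can select the first pair for which both flags are raised. -/
theorem exists_isLOCC_select (M : ℕ) [NeZero M] {σ : Matrix (Option (Fin 2) × Option (Fin 2))
    (Option (Fin 2) × Option (Fin 2)) ℂ} (hσ : IsState σ)
    (hM : (tensorPow (Fin M) σ).PosSemidef) (w : Fin 2 × Fin 2 → ℂ) :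
    ∃ Λ, IsLOCC Λ ∧ IsState (Λ (tensorPow (Fin M) σ)) ∧
      ∑ i : Fin M,
        (1 - ∑ x : Fin 2 × Fin 2, σ (some x.1, some x.2) (some x.1, some x.2)) ^ (i : ℕ) *
          expectation σ (flagExtend w) ≤ expectation (Λ (tensorPow (Fin M) σ)) w := by
  classical
  obtain ⟨sel, hsel⟩ := exists_select M
  -- The protocol: `K` announces the first party's flags; `L` lets the second party extract its
  -- qubit at the selected position and store that position; `L'` announces the position; `K'`
  -- extracts the first party's qubit there.
  let K : (Fin M → Bool) → Matrix (Fin M → Option (Fin 2)) (Fin M → Option (Fin 2)) ℂ :=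
    basisKraus fun s => (s, flags s)
  let L : (Fin M → Bool) → (Fin M → Option (Fin 2)) →
      Matrix (Fin M × Fin 2) (Fin M → Option (Fin 2)) ℂ := fun c =>
    basisKraus fun t => ((sel c t, (pick (sel c t) t).1), (pick (sel c t) t).2)
  let L' : Fin M → Matrix (Fin 2) (Fin M × Fin 2) ℂ := basisKraus fun p => (p.2, p.1)
  let K' : Fin M → (Fin M → Option (Fin 2)) → Matrix (Fin 2) (Fin M → Option (Fin 2)) ℂ :=
    fun i => basisKraus (pick i)
  have hK : ∑ c, (K c).conjTranspose * K c = 1 :=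
    sum_basisKraus _ fun s t h => congrArg Prod.fst h
  have hL : ∀ c, ∑ r, (L c r).conjTranspose * L c r = 1 := fun c => by
    refine sum_basisKraus _ fun s t h => ?_
    have h1 : sel c s = sel c t := congrArg (fun z => z.1.1) h
    refine pick_injective (sel c s) ?_
    have h2 := congrArg (fun z => (z.1.2, z.2)) h
    simp only at h2
    rw [← h1] at h2
    exact h2
  have hL' : ∑ i, (L' i).conjTranspose * L' i = 1 :=
    sum_basisKraus _ fun s t h => Prod.swap_injective h
  have hK' : ∀ i, ∑ r, (K' i r).conjTranspose * K' i r = 1 := fun i =>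
    sum_basisKraus _ (pick_injective i)
  refine ⟨_, .comp (isLOCC_krausMap_right K L hK hL) (isLOCC_krausMap_left K' L' hK' hL'),
    isState_krausMap (sum_kronecker_left hK' hL')
      (isState_krausMap (sum_kronecker_right hK hL) ⟨hM, ?_⟩), ?_⟩
  · rw [trace_tensorPow, hσ.2, one_pow]
  have hsum := fun i => sum_prod_first_success (M := M) σ hσ.2 (expectation σ (flagExtend w)) i
  generalize ∑ x : Fin 2 × Fin 2, σ (some x.1, some x.2) (some x.1, some x.2) = p at hsum ⊢
  rw [LinearMap.comp_apply, expectation_krausMap, Fintype.sum_prod_type]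
  refine Finset.sum_le_sum fun i _ => ?_
  simp only [expectation_krausMap, Fintype.sum_prod_type]
  rw [← hsum, Fintype.sum_prod_type]
  refine Finset.sum_le_sum fun r' _ => ?_
  -- All Kraus terms are nonnegative, so the lower bound may keep only the announcement `c = flags
  -- r'` consistent with the first party's discarded record `r'`.
  have hnonneg : ∀ c ∈ Finset.univ, 0 ≤ ∑ r, expectation (tensorPow (Fin M) σ)
      ((K c ⊗ₖ L c r).conjTranspose.mulVec ((K' i r' ⊗ₖ L' i).conjTranspose.mulVec w)) :=
    fun c _ => Finset.sum_nonneg fun r _ => expectation_nonneg hM _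
  refine le_trans ?_ (Finset.single_le_sum hnonneg (Finset.mem_univ (flags r')))
  refine Finset.sum_le_sum fun r _ => ?_
  -- Records blanked at `i` and without an earlier joint success pull `w` back to a product vector;
  -- for all others the product on the left has a zero factor.
  by_cases hgood : (r' i = some 0 ∧ r i = some 0) ∧
    ∀ j < i, ¬((r' j).isSome = true ∧ (r j).isSome = true)
  · obtain ⟨⟨h1, h2⟩, h3⟩ := hgood
    have hv : (K (flags r') ⊗ₖ L (flags r') r).conjTranspose.mulVec
        ((K' i r' ⊗ₖ L' i).conjTranspose.mulVec w) =
        prodVec fun j => if j = i then flagExtend w else Pi.single (r' j, r j) 1 := by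
      ext ⟨s, t⟩
      rw [prodVec_ite_apply]
      simp only [K, L, K', L', basisKraus_kronecker, conjTranspose_basisKraus_mulVec,
        ← ite_and, pick, Prod.mk.injEq]
      have hiff : ((flags s = flags r' ∧ blank (sel (flags r') t) t = r) ∧
          blank i s = r' ∧ sel (flags r') t = i) ↔
          ((s i).isSome = true ∧ (t i).isSome = true) ∧ ∀ j ≠ i, s j = r' j ∧ t j = r j := by
        constructor
        · rintro ⟨⟨-, ht⟩, hs, hi⟩
          rw [hi, blank_eq_iff h2] at ht
          rw [blank_eq_iff h1] at hs
          exact ⟨⟨hs.1, ht.1⟩, fun j hj => ⟨hs.2 j hj, ht.2 j hj⟩⟩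
        · rintro ⟨⟨hs, ht⟩, h⟩
          have hi : sel (flags r') t = i := by
            refine hsel _ _ _ (by simp [flags, h1]) ht fun j hj => ?_
            rw [(h j hj.ne).2]
            exact h3 j hj
          refine ⟨⟨?_, ?_⟩, ?_, hi⟩
          · ext1 j
            rcases eq_or_ne j i with rfl | hj
            · simp [flags, h1, hs]
            · simp [flags, (h j hj).1]
          · rw [hi, blank_eq_iff h2]
            exact ⟨ht, fun j hj => (h j hj).2⟩
          · rw [blank_eq_iff h1]
            exact ⟨hs, fun j hj => (h j hj).1⟩
      by_cases hc : ((flags s = flags r' ∧ blank (sel (flags r') t) t = r) ∧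
          blank i s = r' ∧ sel (flags r') t = i)
      · rw [if_pos hc, if_pos (hiff.mp hc), hc.2.2]
      · rw [if_neg hc, if_neg (mt hiff.mpr hc)]
    rw [hv, expectation_tensorPow_prodVec]
    refine (Finset.prod_congr rfl fun j _ => ?_).le
    split_ifs with ha hb hc
    · rfl
    · subst ha; simp [h1, h2] at hb
    · exact absurd hc.2 (h3 j hc.1)
    · exact (sesqForm_single _ _ _).symm
  · refine le_of_eq_of_le ?_ (expectation_nonneg hM _)
    rw [not_and_or] at hgood
    rcases hgood with h | h
    · refine Finset.prod_eq_zero (Finset.mem_univ i) ?_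
      simpa using fun h1 h2 => absurd ⟨h1, h2⟩ h
    · push Not at h
      obtain ⟨j, hj, h1⟩ := h
      refine Finset.prod_eq_zero (Finset.mem_univ j) ?_
      rw [if_neg hj.ne, if_pos ⟨hj, h1⟩]

/-! ### Local filters -/

open scoped MatrixOrder in
theorem Matrix.exists_eq_conjTranspose_mul_self {A : Type*} [Fintype A]
    {X : Matrix A A ℂ} (hX : X.PosSemidef) : ∃ R : Matrix A A ℂ, X = R.conjTranspose * R := by
  classical
  exact CStarAlgebra.nonneg_iff_eq_star_mul_self.mp hX.nonneg

theorem posSemidef_tensorPow {ι A B : Type*} [Fintype ι] [Fintype A] [Fintype B]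
    {ρ : Matrix (A × B) (A × B) ℂ} (hρ : ρ.PosSemidef) : (tensorPow ι ρ).PosSemidef := by
  classical
  obtain ⟨R, rfl⟩ := Matrix.exists_eq_conjTranspose_mul_self hρ
  have h : tensorPow ι (R.conjTranspose * R) = (tensorPow ι R).conjTranspose * tensorPow ι R := by
    ext p q
    simp only [tensorPow, Matrix.of_apply, Matrix.mul_apply, Matrix.conjTranspose_apply, star_prod,
      ← Finset.prod_mul_distrib]
    exact (sum_prod_arrow fun i r => star (R r (p.1 i, p.2 i)) * R r (q.1 i, q.2 i)).symm
  rw [h]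
  exact Matrix.posSemidef_conjTranspose_mul_self _

theorem isState_tensorPow {ι A B : Type*} [Fintype ι] [Fintype A] [Fintype B]
    [DecidableEq ι] {ρ : Matrix (A × B) (A × B) ℂ} (hρ : IsState ρ) :
    IsState (tensorPow ι ρ) :=   ⟨posSemidef_tensorPow hρ.1, by rw [trace_tensorPow, hρ.2, one_pow]⟩

/-- Kraus operators of the channel that applies the filter `S` and flags its success. -/
def filterKraus {T : Type*} [DecidableEq T] (S : Matrix (Fin 2) T ℂ) :
    Option T → Matrix (Option (Fin 2)) T ℂ
  | none => Matrix.of fun q u => q.elim 0 fun x => S x u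
  | some z => Matrix.of fun q u => q.elim ((1 - S.conjTranspose * S : Matrix T T ℂ) z u) 0

/-- `S† S` is a projection because `S S† = 1`. The Kraus index `none` is the success branch, with
outputs `some x`; the indices `some z` resolve the complementary projection and output `none`. -/
theorem sum_filterKraus {T : Type*} [Fintype T] [DecidableEq T] {S : Matrix (Fin 2) T ℂ}
    (hS : S * S.conjTranspose = 1) :
    ∑ z, (filterKraus S z).conjTranspose * filterKraus S z = 1 := by
  have h0 : (filterKraus S none).conjTranspose * filterKraus S none = S.conjTranspose * S := by
    ext u v
    simp [Matrix.mul_apply, filterKraus, Fintype.sum_option]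
  have h1 : ∑ z, (filterKraus S (some z)).conjTranspose * filterKraus S (some z) =
      (1 - S.conjTranspose * S).conjTranspose * (1 - S.conjTranspose * S) := by
    ext u v
    rw [Matrix.sum_apply, Matrix.mul_apply]
    refine Finset.sum_congr rfl fun z _ => ?_
    rw [Matrix.mul_apply, Fintype.sum_option]
    simp [filterKraus]
  have h2 : S.conjTranspose * S * (S.conjTranspose * S) = S.conjTranspose * S := by
    rw [Matrix.mul_assoc, ← Matrix.mul_assoc S, hS, Matrix.one_mul]
  rw [Fintype.sum_option, h0, h1, Matrix.conjTranspose_sub, Matrix.conjTranspose_mul,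
    Matrix.conjTranspose_conjTranspose, Matrix.conjTranspose_one, Matrix.sub_mul, Matrix.mul_sub,
    Matrix.mul_sub, h2]
  simp

theorem krausMap_filterKraus_apply {T : Type*} [Fintype T] [DecidableEq T]
    (S : Matrix (Fin 2) T ℂ) (σ : Matrix (T × T) (T × T) ℂ) (x y x' y' : Fin 2) :
    krausMap (fun z : Option T × Option T => filterKraus S z.1 ⊗ₖ filterKraus S z.2) σ
        (some x, some y) (some x', some y') =
      ((S ⊗ₖ S) * σ * (S ⊗ₖ S).conjTranspose) (x, y) (x', y') := by
  have h1 : ∀ z x, filterKraus S (some z) (some x) = 0 := fun z x => rfl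
  have h2 : ∀ x, filterKraus S none (some x) = S x := fun x => rfl
  rw [krausMap_apply, Matrix.sum_apply, Finset.sum_eq_single (none, none)]
  · simp only [Matrix.mul_apply, Matrix.conjTranspose_apply, Matrix.kroneckerMap_apply, h2]
  · rintro ⟨_ | z1, _ | z2⟩ _ hz
    · exact absurd rfl hz
    all_goals
      simp [Matrix.mul_apply, Matrix.conjTranspose_apply, Matrix.kroneckerMap_apply, h1]
  · simp

theorem expectation_flagExtend (σ : Matrix (Option (Fin 2) × Option (Fin 2))
    (Option (Fin 2) × Option (Fin 2)) ℂ) (w : Fin 2 × Fin 2 → ℂ) :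
    expectation σ (flagExtend w) = expectation (Matrix.of fun p q : Fin 2 × Fin 2 =>
      σ (some p.1, some p.2) (some q.1, some q.2)) w := by
  change sesqForm _ _ _ = sesqForm _ _ _
  simp [sesqForm_eq_sum, Fintype.sum_prod_type, Fintype.sum_option, flagExtend]

/-- Filtering both sides of many copies of `σ` with `S`, and keeping the first success. -/
theorem exists_isLOCC_filter {T : Type} [Fintype T] [DecidableEq T] {S : Matrix (Fin 2) T ℂ}
    (hS : S * S.conjTranspose = 1) {σ : Matrix (T × T) (T × T) ℂ} (hσ : IsState σ)
    (M : ℕ) [NeZero M] (w : Fin 2 × Fin 2 → ℂ) :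
    ((S ⊗ₖ S) * σ * (S ⊗ₖ S).conjTranspose).trace ≤ 1 ∧
    ∃ Λ, IsLOCC Λ ∧ IsState (Λ (tensorPow (Fin M) σ)) ∧
      ∑ i : Fin M, (1 - ((S ⊗ₖ S) * σ * (S ⊗ₖ S).conjTranspose).trace) ^ (i : ℕ) *
        expectation ((S ⊗ₖ S) * σ * (S ⊗ₖ S).conjTranspose) w ≤
          expectation (Λ (tensorPow (Fin M) σ)) w := by
  have hK := sum_filterKraus hS
  set σ' := krausMap (fun z : Option T × Option T => filterKraus S z.1 ⊗ₖ filterKraus S z.2) σ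
    with hσ'
  have hst : IsState σ' := isState_krausMap (sum_kronecker_right hK fun _ => hK) hσ
  obtain ⟨Λ, h1, h2, h3⟩ := exists_isLOCC_select M hst (posSemidef_tensorPow hst.1) w
  have htr : ∑ x : Fin 2 × Fin 2, σ' (some x.1, some x.2) (some x.1, some x.2) =
      ((S ⊗ₖ S) * σ * (S ⊗ₖ S).conjTranspose).trace := by
    simp only [hσ', krausMap_filterKraus_apply]
    rfl
  have hex : expectation σ' (flagExtend w) =
      expectation ((S ⊗ₖ S) * σ * (S ⊗ₖ S).conjTranspose) w := by
    rw [expectation_flagExtend]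
    congr 1
    ext p q
    exact krausMap_filterKraus_apply S σ _ _ _ _
  rw [htr, hex] at h3
  have hchan : krausMap (fun z : (Fin M → Option T) × (Fin M → Option T) =>
      tensorKraus (Fin M) (filterKraus S) z.1 ⊗ₖ tensorKraus (Fin M) (filterKraus S) z.2)
      (tensorPow (Fin M) σ) = tensorPow (Fin M) σ' := krausMap_tensorPow _ _ _
  refine ⟨?_, _, .comp (isLOCC_krausMap_local _ _ (sum_tensorKraus (ι := Fin M) _ hK)
    (sum_tensorKraus (ι := Fin M) _ hK)) h1, ?_, ?_⟩
  -- The trace collects the diagonal entries of the state `σ'` with both flags raised.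
  · rw [← htr, ← hst.2, Matrix.trace]
    have hd : ∀ q, 0 ≤ σ' q q := fun q => hst.1.diag_nonneg
    have hinj : Function.Injective (fun x : Fin 2 × Fin 2 => (some x.1, some x.2)) := by
      rintro ⟨a, b⟩ ⟨c, d⟩ h
      simpa using h
    refine (Finset.sum_map Finset.univ ⟨_, hinj⟩ fun q => σ' q q).symm.trans_le ?_
    exact Finset.sum_le_sum_of_subset_of_nonneg (Finset.subset_univ _) fun q _ _ => hd q
  · rw [LinearMap.comp_apply, hchan]; exact h2
  · rw [LinearMap.comp_apply, hchan]; exact h3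

/-! ### Filters built from repetition codes -/

/-- The filter whose rows are tensor powers of the rows of `h`. -/
def rowPow {C T : Type*} (m : ℕ) (h : Matrix C T ℂ) : Matrix C (Fin m → T) ℂ :=
  Matrix.of fun x u => ∏ j, h x (u j)

theorem rowPow_mul_conjTranspose {C T : Type*} [Fintype T] (m : ℕ) (h : Matrix C T ℂ) (x y : C) :
    (rowPow m h * (rowPow m h).conjTranspose) x y = (h * h.conjTranspose) x y ^ m := by
  simp only [Matrix.mul_apply, rowPow, Matrix.of_apply, Matrix.conjTranspose_apply, star_prod,
    ← Finset.prod_mul_distrib]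
  rw [← Fintype.piFinset_univ, ← Finset.prod_univ_sum (fun _ => Finset.univ)
    fun (_ : Fin m) t => h x t * star (h y t)]
  simp

/-- Tensor powers of orthonormal rows are orthonormal; for `m = 0` the off-diagonal inner products
would be `0 ^ 0 = 1`. -/
theorem rowPow_mul_conjTranspose_eq_one {C T : Type*} [Fintype T] [DecidableEq C] {m : ℕ}
    (hm : m ≠ 0) {h : Matrix C T ℂ} (hh : h * h.conjTranspose = 1) :
    rowPow m h * (rowPow m h).conjTranspose = 1 := by
  ext x y
  rw [rowPow_mul_conjTranspose, hh, Matrix.one_apply]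
  split_ifs <;> simp [hm]

/-- The rows of the filter are product vectors, so each entry factors over the copies. Entrywise
powers are the whole distillation mechanism: they suppress the smaller entries relative to the
larger. -/
theorem rowPow_conj_tensorPow {C T : Type*} [Fintype T] (m : ℕ) (h : Matrix C T ℂ)
    (σ : Matrix (T × T) (T × T) ℂ) (p q : C × C) :
    ((rowPow m h ⊗ₖ rowPow m h) * tensorPow (Fin m) σ *
        (rowPow m h ⊗ₖ rowPow m h).conjTranspose) p q =
      ((h ⊗ₖ h) * σ * (h ⊗ₖ h).conjTranspose) p q ^ m := by
  have hrow : ∀ p, star ((rowPow m h ⊗ₖ rowPow m h) p) =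
      prodVec fun _ : Fin m => star ((h ⊗ₖ h) p) := by
    intro p
    ext u
    simp [prodVec, rowPow, Matrix.kroneckerMap_apply, Finset.prod_mul_distrib]
  simp [mul_mul_conjTranspose_apply, hrow, sesqForm_tensorPow]

/-- The Hadamard gate. -/
def hadamardGate : Matrix (Fin 2) (Fin 2) ℂ := ((√2 : ℝ) : ℂ)⁻¹ • !![1, 1; 1, -1]

theorem inv_sqrt_two_mul_self : ((√2 : ℝ) : ℂ)⁻¹ * ((√2 : ℝ) : ℂ)⁻¹ = 1 / 2 := by
  rw [← mul_inv, ← Complex.ofReal_mul, Real.mul_self_sqrt zero_le_two]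
  norm_num

theorem conjTranspose_hadamardGate : hadamardGate.conjTranspose = hadamardGate := by
  ext i j
  fin_cases i <;> fin_cases j <;> simp [hadamardGate]

theorem hadamardGate_mul_self : hadamardGate * hadamardGate = 1 := by
  rw [hadamardGate, Matrix.smul_mul, Matrix.mul_smul, smul_smul, inv_sqrt_two_mul_self]
  ext i j
  fin_cases i <;> fin_cases j <;> norm_num [Matrix.mul_apply, Fin.sum_univ_two]

/-- The filter projecting onto the concatenation of two repetition codes, in complementary
bases. -/
def codeFilter (m k : ℕ) : Matrix (Fin 2) (Fin m → Fin k → Fin 2) ℂ :=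
  rowPow m (hadamardGate * rowPow k (1 : Matrix (Fin 2) (Fin 2) ℂ))

theorem codeFilter_mul_conjTranspose {m k : ℕ} (hm : m ≠ 0) (hk : k ≠ 0) :
    codeFilter m k * (codeFilter m k).conjTranspose = 1 := by
  refine rowPow_mul_conjTranspose_eq_one hm ?_
  rw [Matrix.conjTranspose_mul, Matrix.mul_assoc,
    ← Matrix.mul_assoc (rowPow k (1 : Matrix (Fin 2) (Fin 2) ℂ)),
    rowPow_mul_conjTranspose_eq_one hk (by simp), Matrix.one_mul, conjTranspose_hadamardGate,
    hadamardGate_mul_self]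

/-- Two-qubit operators with diagonal entries `a, b, b, a` and off-diagonal entries `c` between
`|00⟩` and `|11⟩`. -/
def isoMatrix (a b c : ℝ) : Matrix (Fin 2 × Fin 2) (Fin 2 × Fin 2) ℂ :=
  Matrix.of fun p q =>
    if p.1 = p.2 then (if q = p then (a : ℂ) else if q.1 = q.2 then (c : ℂ) else 0)
    else (if q = p then (b : ℂ) else 0)

theorem codeFilter_conj_isoMatrix {m k : ℕ} (hk : k ≠ 0) (a b c : ℝ) :
    (codeFilter m k ⊗ₖ codeFilter m k) * tensorPow (Fin m) (tensorPow (Fin k) (isoMatrix a b c)) *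
        (codeFilter m k ⊗ₖ codeFilter m k).conjTranspose =
      Matrix.of fun p q => ((hadamardGate ⊗ₖ hadamardGate) * isoMatrix (a ^ k) (b ^ k) (c ^ k) *
        (hadamardGate ⊗ₖ hadamardGate)) p q ^ m := by
  ext p q
  have h1 : (rowPow k (1 : Matrix (Fin 2) (Fin 2) ℂ) ⊗ₖ rowPow k (1 : Matrix (Fin 2) (Fin 2) ℂ)) *
      tensorPow (Fin k) (isoMatrix a b c) * (rowPow k (1 : Matrix (Fin 2) (Fin 2) ℂ) ⊗ₖ
        rowPow k (1 : Matrix (Fin 2) (Fin 2) ℂ)).conjTranspose =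
      isoMatrix (a ^ k) (b ^ k) (c ^ k) := by
    ext p q
    rw [rowPow_conj_tensorPow]
    simp only [Matrix.one_kronecker_one, Matrix.one_mul, Matrix.conjTranspose_one, Matrix.mul_one,
      isoMatrix, Matrix.of_apply]
    split_ifs <;> simp [hk]
  rw [codeFilter, rowPow_conj_tensorPow, Matrix.of_apply, Matrix.mul_kronecker_mul,
    Matrix.conjTranspose_mul, ← h1, Matrix.conjTranspose_kronecker hadamardGate,
    conjTranspose_hadamardGate]
  simp only [Matrix.mul_assoc]

theorem hadamard_conj_isoMatrix (a b c : ℝ) (x y x' y' : Fin 2) :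
    ((hadamardGate ⊗ₖ hadamardGate) * isoMatrix a b c * (hadamardGate ⊗ₖ hadamardGate))
      (x, y) (x', y') = 1 / 4 *
        (((!![1, 1; 1, -1] : Matrix (Fin 2) (Fin 2) ℂ) ⊗ₖ
          (!![1, 1; 1, -1] : Matrix (Fin 2) (Fin 2) ℂ)) *
        isoMatrix a b c * ((!![1, 1; 1, -1] : Matrix (Fin 2) (Fin 2) ℂ) ⊗ₖ
          (!![1, 1; 1, -1] : Matrix (Fin 2) (Fin 2) ℂ)))
          (x, y) (x', y') := by
  have h : hadamardGate ⊗ₖ hadamardGate =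
      (1 / 2 : ℂ) • ((!![1, 1; 1, -1] : Matrix (Fin 2) (Fin 2) ℂ) ⊗ₖ
          (!![1, 1; 1, -1] : Matrix (Fin 2) (Fin 2) ℂ)) := by
    rw [hadamardGate, Matrix.smul_kronecker, Matrix.kronecker_smul, smul_smul,
      inv_sqrt_two_mul_self]
  rw [h, Matrix.smul_mul, Matrix.smul_mul, Matrix.mul_smul, smul_smul, Matrix.smul_apply,
    smul_eq_mul]
  norm_num

/-- With `k`-th powers in place of `a, b, c`, this is the success probability of a block. -/
theorem trace_hadamard_conj_isoMatrix_pow (a b c : ℝ) (m : ℕ) :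
    (Matrix.of fun p q => ((hadamardGate ⊗ₖ hadamardGate) * isoMatrix a b c *
        (hadamardGate ⊗ₖ hadamardGate)) p q ^ m).trace =
      ((2 * (((a + b + c) / 2) ^ m + ((a - c + b) / 2) ^ m) : ℝ) : ℂ) := by
  have h0 : ∀ x, ((hadamardGate ⊗ₖ hadamardGate) * isoMatrix a b c *
        (hadamardGate ⊗ₖ hadamardGate)) (x, x) (x, x) = (((a + b + c) / 2 : ℝ) : ℂ) := by
    intro x
    rw [hadamard_conj_isoMatrix]
    fin_cases x <;>
    simp [Matrix.mul_apply, Fintype.sum_prod_type, isoMatrix] <;> ring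
  have h1 : ∀ x y, x ≠ y → ((hadamardGate ⊗ₖ hadamardGate) * isoMatrix a b c *
        (hadamardGate ⊗ₖ hadamardGate)) (x, y) (x, y) = (((a - c + b) / 2 : ℝ) : ℂ) := by
    intro x y hxy
    rw [hadamard_conj_isoMatrix]
    fin_cases x <;> fin_cases y <;> first | exact absurd rfl hxy | skip
    all_goals simp [Matrix.mul_apply, Fintype.sum_prod_type, isoMatrix]; ring
  simp only [Matrix.trace, Matrix.diag_apply, Matrix.of_apply, Fintype.sum_prod_type,
    Fin.sum_univ_two, h0, h1 0 1 (by decide), h1 1 0 (by decide)]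
  push_cast
  ring

/-- The unnormalised fidelity of a successful block; dividing by the trace above gives the
conditional fidelity. -/
theorem expectation_hadamard_conj_isoMatrix_pow (a b c : ℝ) (m : ℕ) :
    expectation (Matrix.of fun p q => ((hadamardGate ⊗ₖ hadamardGate) * isoMatrix a b c *
        (hadamardGate ⊗ₖ hadamardGate)) p q ^ m) phiPlusVec =
      ((((a + b + c) / 2) ^ m + ((a + c - b) / 2) ^ m : ℝ) : ℂ) := by
  have h0 : ∀ x, ((hadamardGate ⊗ₖ hadamardGate) * isoMatrix a b c *
        (hadamardGate ⊗ₖ hadamardGate)) (x, x) (x, x) = (((a + b + c) / 2 : ℝ) : ℂ) := by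
    intro x
    rw [hadamard_conj_isoMatrix]
    fin_cases x <;>
    simp [Matrix.mul_apply, Fintype.sum_prod_type, isoMatrix] <;> ring
  have h1 : ∀ x y, x ≠ y → ((hadamardGate ⊗ₖ hadamardGate) * isoMatrix a b c *
        (hadamardGate ⊗ₖ hadamardGate)) (x, x) (y, y) = (((a + c - b) / 2 : ℝ) : ℂ) := by
    intro x y hxy
    rw [hadamard_conj_isoMatrix]
    fin_cases x <;> fin_cases y <;> first | exact absurd rfl hxy | skip
    all_goals simp [Matrix.mul_apply, Fintype.sum_prod_type, isoMatrix]; ring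
  have h2 : ∀ z : ℂ, ((√2 : ℝ) : ℂ)⁻¹ * z * ((√2 : ℝ) : ℂ)⁻¹ = 1 / 2 * z := by
    intro z
    rw [mul_right_comm, inv_sqrt_two_mul_self]
  change sesqForm _ _ _ = _
  simp only [sesqForm_eq_sum, Matrix.of_apply, Fintype.sum_prod_type, Fin.sum_univ_two, h0,
    h1 0 1 (by decide), h1 1 0 (by decide), phiPlusVec]
  simp [h2, Complex.conj_ofReal]
  ring

/-! ### Distillation -/

/-- The conditional fidelity is `(1 + x^m) / (2 (1 + y^m))` with `x = 1 - 2B/(A+B+C)` and `y = 1 -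
2C/(A+B+C)`. So `m` must be large against `A/C` to kill `y^m`, yet small against `A/B` to keep `x^m`
near `1`; the bound `hk` on `B/C` leaves room for both. -/
theorem exists_code_length {A B C ε : ℝ} (hB : 0 ≤ B) (hC : 0 < C) (hBC : B ≤ C) (hCA : C ≤ A)
    (hε : 0 < ε) (hk : (3 / ε + 1) * (B / C) < ε / 2) : ∃ m : ℕ, m ≠ 0 ∧
      0 < 2 * (((A + B + C) / 2) ^ m + ((A - C + B) / 2) ^ m) ∧
      (1 - ε) * (2 * (((A + B + C) / 2) ^ m + ((A - C + B) / 2) ^ m)) ≤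
        ((A + B + C) / 2) ^ m + ((A + C - B) / 2) ^ m := by
  have hA : 0 < A := hC.trans_le hCA
  have hl : 0 < 3 / ε * (A / C) := by positivity
  -- The `3` offsets `A + B + C ≤ 3A`, so that `y^m ≤ exp(-2/ε) ≤ ε/2`; the `+ 1` in `hk` absorbs
  -- the ceiling.
  refine ⟨⌈3 / ε * (A / C)⌉₊, (Nat.ceil_pos.mpr hl).ne', ?_⟩
  have hm1 := Nat.le_ceil (3 / ε * (A / C))
  have hm2 := (Nat.ceil_lt_add_one hl.le).le
  generalize ⌈3 / ε * (A / C)⌉₊ = m at *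
  have hD : 0 < (A + B + C) / 2 := by positivity
  have hpow : 0 < ((A + B + C) / 2) ^ m := pow_pos hD m
  have hy0 : 0 ≤ 1 - 2 * C / (A + B + C) := by
    rw [sub_nonneg, div_le_one (by positivity)]; linarith
  have hy : (A - C + B) / 2 = (A + B + C) / 2 * (1 - 2 * C / (A + B + C)) := by
    field_simp; ring
  have hx : (A + C - B) / 2 = (A + B + C) / 2 * (1 + -(2 * B / (A + B + C))) := by
    field_simp; ring
  rw [hy, hx, mul_pow, mul_pow]
  have hxm : 1 + (m : ℝ) * -(2 * B / (A + B + C)) ≤ (1 + -(2 * B / (A + B + C))) ^ m := by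
    refine one_add_mul_le_pow ?_ m
    have : 2 * B / (A + B + C) ≤ 1 := by rw [div_le_one (by positivity)]; linarith
    linarith
  have hmB : (m : ℝ) * (2 * B / (A + B + C)) ≤ ε := by
    have h1 : 2 * B / (A + B + C) ≤ 2 * (B / A) := by
      rw [mul_div_assoc]; gcongr; linarith
    have h2 : (m : ℝ) * (B / A) ≤ (3 / ε + 1) * (B / C) := by
      calc (m : ℝ) * (B / A) ≤ (3 / ε * (A / C) + 1) * (B / A) := by gcongr
        _ = 3 / ε * (B / C) + B / A := by field_simp
        _ ≤ 3 / ε * (B / C) + B / C := by gcongr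
        _ = _ := by ring
    calc (m : ℝ) * (2 * B / (A + B + C)) ≤ m * (2 * (B / A)) := by gcongr
      _ = 2 * (m * (B / A)) := by ring
      _ ≤ ε := by linarith
  have hym : (1 - 2 * C / (A + B + C)) ^ m ≤ ε / 2 := by
    have h1 : 2 / 3 * (C / A) ≤ 2 * C / (A + B + C) := by
      rw [div_mul_div_comm, div_le_div_iff₀ (by positivity) (by positivity)]
      nlinarith
    have h3 : 3 / ε ≤ m * (C / A) := by
      calc 3 / ε = 3 / ε * (A / C) * (C / A) := by field_simp
        _ ≤ _ := by gcongr
    have h4 : 1 - 2 * C / (A + B + C) ≤ Real.exp (-(2 / 3 * (C / A))) := by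
      have := Real.add_one_le_exp (-(2 / 3 * (C / A)))
      linarith
    calc (1 - 2 * C / (A + B + C)) ^ m ≤ Real.exp (-(2 / 3 * (C / A))) ^ m := by gcongr
      _ = Real.exp (-(2 / 3 * (m * (C / A)))) := by rw [← Real.exp_nat_mul]; ring_nf
      _ ≤ Real.exp (-(2 / ε)) := by
          rw [Real.exp_le_exp, neg_le_neg_iff]
          calc 2 / ε = 2 / 3 * (3 / ε) := by field_simp
            _ ≤ _ := by gcongr
      _ ≤ (2 / ε)⁻¹ := by
          rw [Real.exp_neg]
          gcongr
          linarith [Real.add_one_le_exp (2 / ε)]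
      _ = ε / 2 := by rw [inv_div]
  have hy1 := pow_nonneg hy0 m
  refine ⟨by positivity, ?_⟩
  generalize (1 - 2 * C / (A + B + C)) ^ m = y at *
  generalize (1 + -(2 * B / (A + B + C))) ^ m = x at *
  have key : (1 - ε) * (2 * (1 + y)) ≤ 1 + x := by nlinarith
  nlinarith

/-- Since `b < c`, which for an isotropic state of trace one means fidelity above `1/2`, the ratio
`(b/c)^k` tends to `0` and some `k` meets the requirement of `exists_code_length`. -/
theorem exists_code_parameters {a b c : ℝ} (hb : 0 ≤ b) (hbc : b < c) (hca : c ≤ a) {ε : ℝ}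
    (hε : 0 < ε) : ∃ m k : ℕ, m ≠ 0 ∧ k ≠ 0 ∧
      0 < 2 * (((a ^ k + b ^ k + c ^ k) / 2) ^ m + ((a ^ k - c ^ k + b ^ k) / 2) ^ m) ∧
      (1 - ε) * (2 * (((a ^ k + b ^ k + c ^ k) / 2) ^ m + ((a ^ k - c ^ k + b ^ k) / 2) ^ m)) ≤
        ((a ^ k + b ^ k + c ^ k) / 2) ^ m + ((a ^ k + c ^ k - b ^ k) / 2) ^ m := by
  have hc : 0 < c := hb.trans_lt hbc
  have hr : Filter.Tendsto (fun k : ℕ => (3 / ε + 1) * (b / c) ^ k) Filter.atTop (nhds 0) := by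
    simpa using (tendsto_pow_atTop_nhds_zero_of_lt_one (div_nonneg hb hc.le)
      ((div_lt_one hc).mpr hbc)).const_mul (3 / ε + 1)
  obtain ⟨k, hk, hk1⟩ := ((hr.eventually (gt_mem_nhds (half_pos hε))).and
    (Filter.eventually_ge_atTop 1)).exists
  rw [div_pow] at hk
  obtain ⟨m, hm, h1, h2⟩ := exists_code_length (pow_nonneg hb k) (pow_pos hc k)
    (pow_le_pow_left₀ hb hbc.le k) (pow_le_pow_left₀ hc.le hca k) hε hk
  exact ⟨m, k, hm, by omega, h1, h2⟩

/-- A block succeeds with probability `P` and has unnormalised fidelity `G ≥ (1 - ε/2) P`. Keeping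
the first success among `M + 1` blocks gives a geometric sum, hence fidelity at least `(1 - ε/2) (1
- (1 - P)^(M+1))`. -/
theorem exists_isLOCC_fidelity {a b c : ℝ} (hb : 0 ≤ b) (hbc : b < c) (hca : c ≤ a)
    (hst : IsState (isoMatrix a b c)) {ε : ℝ} (hε : 0 < ε) :
    ∃ N : ℕ, ∀ n ≥ N, ∃ Λ, IsLOCC Λ ∧ IsState (Λ (tensorPower (isoMatrix a b c) n)) ∧
      1 - ε ≤ (expectation (Λ (tensorPower (isoMatrix a b c) n)) phiPlusVec).re := by
  obtain ⟨m, k, hm, hk, hP, hG⟩ := exists_code_parameters hb hbc hca (half_pos hε)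
  have hS := codeFilter_mul_conjTranspose hm hk
  have hσ : IsState (tensorPow (Fin m) (tensorPow (Fin k) (isoMatrix a b c))) :=
    isState_tensorPow (isState_tensorPow hst)
  have hcode := fun M [NeZero M] => exists_isLOCC_filter hS hσ M phiPlusVec
  simp only [codeFilter_conj_isoMatrix hk, trace_hadamard_conj_isoMatrix_pow,
    expectation_hadamard_conj_isoMatrix_pow] at hcode
  generalize 2 * (((a ^ k + b ^ k + c ^ k) / 2) ^ m + ((a ^ k - c ^ k + b ^ k) / 2) ^ m) = P at *
  generalize ((a ^ k + b ^ k + c ^ k) / 2) ^ m + ((a ^ k + c ^ k - b ^ k) / 2) ^ m = G at *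
  have hP1 : P ≤ 1 := by exact_mod_cast (hcode 1).1
  obtain ⟨M, hM⟩ := exists_pow_lt_of_lt_one (half_pos hε) (show 1 - P < 1 by linarith)
  have hM' : (1 - P) ^ (M + 1) < ε / 2 :=
    (pow_le_pow_of_le_one (by linarith) (by linarith) (Nat.le_succ M)).trans_lt hM
  obtain ⟨-, Λ, hΛ, hΛs, hΛf⟩ := hcode (M + 1)
  refine ⟨(M + 1) * m * k, fun n hn => ?_⟩
  -- Surplus copies are discarded; two regroupings produce the nested tensor powers on which the
  -- code filter acts.
  have e : Fin n ≃ ((Fin (M + 1) × Fin m) × Fin k) ⊕ Fin (n - (M + 1) * m * k) :=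
    Fintype.equivOfCardEq (by simp; omega)
  have e' : Fin (M + 1) × Fin m ≃ (Fin (M + 1) × Fin m) ⊕ Fin 0 := (Equiv.sumEmpty _ _).symm
  obtain ⟨Λ₁, h₁, h₁'⟩ := exists_isLOCC_regroup e (isoMatrix a b c) hst.2
  obtain ⟨Λ₂, h₂, h₂'⟩ := exists_isLOCC_regroup e' (tensorPow (Fin k) (isoMatrix a b c))
    (isState_tensorPow hst).2
  refine ⟨_, .comp (.comp h₁ h₂) hΛ, ?_⟩
  rw [tensorPower_eq_tensorPow, LinearMap.comp_apply, LinearMap.comp_apply, h₁', h₂']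
  refine ⟨hΛs, le_trans ?_ (Complex.le_def.mp hΛf).1⟩
  have hre : (∑ i : Fin (M + 1), (1 - (P : ℂ)) ^ (i : ℕ) * (G : ℂ)).re =
      (∑ i ∈ Finset.range (M + 1), (1 - P) ^ i) * G := by
    rw [← Complex.ofReal_re ((∑ i ∈ Finset.range (M + 1), (1 - P) ^ i) * G),
      ← Fin.sum_univ_eq_sum_range, Finset.sum_mul]
    push_cast
    rfl
  rw [hre]
  have hgeom := mul_neg_geom_sum (1 - P) (M + 1)
  have hnn : 0 ≤ ∑ i ∈ Finset.range (M + 1), (1 - P) ^ i :=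
    Finset.sum_nonneg fun i _ => pow_nonneg (by linarith) i
  have hq : 0 ≤ (1 - P) ^ (M + 1) := pow_nonneg (by linarith) _
  calc 1 - ε ≤ (1 - ε / 2) * (1 - (1 - P) ^ (M + 1)) := by nlinarith
    _ = (∑ i ∈ Finset.range (M + 1), (1 - P) ^ i) * ((1 - ε / 2) * P) := by
        rw [← hgeom]; ring
    _ ≤ _ := by gcongr

theorem exists_isLOCC {A B : Type} [Fintype A] [Fintype B] :
    ∃ Λ : Matrix (A × B) (A × B) ℂ →ₗ[ℂ] Matrix (Fin 2 × Fin 2) (Fin 2 × Fin 2) ℂ, IsLOCC Λ := by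
  classical
  exact ⟨_, isLOCC_krausMap_local _ _
    (sum_basisKraus (fun a : A => ((0 : Fin 2), a)) fun _ _ h => congrArg Prod.snd h)
    (sum_basisKraus (fun b : B => ((0 : Fin 2), b)) fun _ _ h => congrArg Prod.snd h)⟩

/-- A single sequence must serve every `ε`: for each `n`, take a protocol whose error is within
`1/(n+1)` of the infimum. -/
theorem isLOCCDistillable_of_eventually {A B : Type} [Fintype A] [Fintype B]
    {ρ : Matrix (A × B) (A × B) ℂ}
    (h : ∀ ε : ℝ, 0 < ε → ∃ N : ℕ, ∀ n ≥ N, ∃ Λ, IsLOCC Λ ∧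
      traceNorm (Λ (tensorPower ρ n) - phiPlus) ≤ ε) : IsLOCCDistillable ρ := by
  have hnn : ∀ X : Matrix (Fin 2 × Fin 2) (Fin 2 × Fin 2) ℂ, 0 ≤ traceNorm X := fun X =>
    Finset.sum_nonneg fun _ _ => Real.sqrt_nonneg _
  let d : ∀ n, {Λ : Matrix ((Fin n → A) × (Fin n → B)) ((Fin n → A) × (Fin n → B)) ℂ →ₗ[ℂ]
      Matrix (Fin 2 × Fin 2) (Fin 2 × Fin 2) ℂ // IsLOCC Λ} → ℝ :=
    fun n Λ => traceNorm (Λ.1 (tensorPower ρ n) - phiPlus)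
  have hbdd : ∀ n, BddBelow (Set.range (d n)) := fun n =>
    ⟨0, by rintro _ ⟨Λ, rfl⟩; exact hnn _⟩
  have hex : ∀ n : ℕ, ∃ Λ, d n Λ < (⨅ Λ, d n Λ) + 1 / ((n : ℝ) + 1) := fun n => by
    obtain ⟨Λ₀, hΛ₀⟩ := exists_isLOCC (A := Fin n → A) (B := Fin n → B)
    have : Nonempty {Λ : Matrix ((Fin n → A) × (Fin n → B)) ((Fin n → A) × (Fin n → B)) ℂ →ₗ[ℂ]
      Matrix (Fin 2 × Fin 2) (Fin 2 × Fin 2) ℂ // IsLOCC Λ} := ⟨⟨Λ₀, hΛ₀⟩⟩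
    exact exists_lt_of_ciInf_lt (lt_add_of_pos_right _ (by positivity))
  choose Λ hΛ using hex
  refine ⟨fun n => (Λ n).1, fun n => (Λ n).2, ?_⟩
  rw [Metric.tendsto_atTop]
  intro ε hε
  obtain ⟨N, hN⟩ := h (ε / 2) (half_pos hε)
  obtain ⟨N', hN'⟩ := exists_nat_one_div_lt (half_pos hε)
  refine ⟨max N N', fun n hn => ?_⟩
  rw [Real.dist_eq, sub_zero, abs_of_nonneg (hnn _)]
  obtain ⟨Θ, hΘ, hΘ'⟩ := hN n (le_of_max_le_left hn)
  have h1 : ⨅ Λ, d n Λ ≤ ε / 2 := (ciInf_le (hbdd n) ⟨Θ, hΘ⟩).trans hΘ'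
  have h2 : 1 / ((n : ℝ) + 1) ≤ 1 / ((N' : ℝ) + 1) := by
    have : (N' : ℝ) ≤ n := by exact_mod_cast le_of_max_le_right hn
    gcongr
  have h3 : traceNorm ((Λ n).1 (tensorPower ρ n) - phiPlus) <
    (⨅ Λ, d n Λ) + 1 / ((n : ℝ) + 1) := hΛ n
  linarith

theorem isLOCCDistillable_isoMatrix {a b c : ℝ} (hb : 0 ≤ b) (hbc : b < c) (hca : c ≤ a)
    (hst : IsState (isoMatrix a b c)) : IsLOCCDistillable (isoMatrix a b c) := by
  refine isLOCCDistillable_of_eventually fun ε hε => ?_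
  -- Infidelity `ε²/8` makes the bound of `traceNorm_sub_phiPlus_le` equal to `ε`.
  obtain ⟨N, hN⟩ := exists_isLOCC_fidelity hb hbc hca hst (show 0 < ε ^ 2 / 8 by positivity)
  refine ⟨N, fun n hn => ?_⟩
  obtain ⟨Λ, h1, h2, h3⟩ := hN n hn
  refine ⟨Λ, h1, (traceNorm_sub_phiPlus_le h2).trans ?_⟩
  calc 2 * √(2 * (1 - (expectation (Λ (tensorPower (isoMatrix a b c) n)) phiPlusVec).re))
      ≤ 2 * √((ε / 2) ^ 2) := by
        gcongr
        linarith
    _ = ε := by rw [Real.sqrt_sq (by positivity)]; ring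

/-! ### Compactness of convex hulls -/

/-- By Carathéodory, at most `finrank + 1` points suffice, so the hull is a finite union of
continuous images of compact sets. -/
theorem IsCompact.convexHull_of_finiteDimensional {E : Type*} [AddCommGroup E] [Module ℝ E]
    [TopologicalSpace E] [ContinuousAdd E] [ContinuousSMul ℝ E] [FiniteDimensional ℝ E]
    {s : Set E} (hs : IsCompact s) : IsCompact (convexHull ℝ s) := by
  let f : ∀ n : ℕ, (Fin n → ℝ) × (Fin n → E) → E := fun n p => ∑ i, p.1 i • p.2 i
  have hf : ∀ n, Continuous (f n) := fun n => by fun_prop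
  have h : convexHull ℝ s = ⋃ n ∈ Finset.range (Module.finrank ℝ E + 2),
      f n '' (stdSimplex ℝ (Fin n) ×ˢ Set.univ.pi fun _ => s) := by
    refine Set.Subset.antisymm (fun x hx => ?_) (Set.iUnion₂_subset fun n _ => ?_)
    · obtain ⟨ι, _, z, w, hz, hind, hw, hw1, rfl⟩ := eq_pos_convex_span_of_mem_convexHull hx
      have hcard := hind.card_le_finrank_succ
      have hle : Fintype.card ι ≤ Module.finrank ℝ E + 1 :=
        hcard.trans (Nat.add_le_add_right (Submodule.finrank_le _) 1)
      refine Set.mem_biUnion (x := Fintype.card ι) (by simpa using by omega) ?_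
      let e := Fintype.equivFin ι
      refine ⟨(w ∘ e.symm, z ∘ e.symm), ⟨⟨fun i => (hw _).le, ?_⟩, fun i _ => hz ⟨_, rfl⟩⟩, ?_⟩
      · rw [← hw1]; exact e.symm.sum_comp w
      · exact e.symm.sum_comp fun i => w i • z i
    · rintro _ ⟨⟨w, z⟩, ⟨⟨hw, hw1⟩, hz⟩, rfl⟩
      exact (convex_convexHull ℝ s).sum_mem (fun i _ => hw i) hw1
        fun i _ => subset_convexHull ℝ s (hz i trivial)
  rw [h]
  exact (Finset.range _).isCompact_biUnion fun n _ =>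
    ((isCompact_stdSimplex ℝ (Fin n)).prod (isCompact_univ_pi fun _ => hs)).image (hf n)

/-! ### The cone of separable operators -/

theorem isCompact_setOf_isState (A : Type*) [Fintype A] :
    IsCompact {ρ : Matrix A A ℂ | IsState ρ} := by
  have hc : IsClosed {ρ : Matrix A A ℂ | IsState ρ} := by
    have h : {ρ : Matrix A A ℂ | IsState ρ} =
        ({ρ | ρ.conjTranspose = ρ} ∩ ⋂ v : A → ℂ, {ρ | 0 ≤ star v ⬝ᵥ ρ.mulVec v}) ∩
          {ρ | ρ.trace = 1} := by
      ext ρ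
      simp [IsState, Matrix.posSemidef_iff_dotProduct_mulVec, Matrix.IsHermitian]
    rw [h]
    refine ((isClosed_eq (by fun_prop) (by fun_prop)).inter (isClosed_iInter fun v => ?_)).inter
      (isClosed_eq (by fun_prop) (by fun_prop))
    exact isClosed_le continuous_const (by fun_prop)
  have hb : IsCompact (Set.univ.pi fun _ : A => Set.univ.pi fun _ : A =>
      Metric.closedBall (0 : ℂ) 1) :=
    isCompact_univ_pi fun _ => isCompact_univ_pi fun _ => isCompact_closedBall _ _
  refine IsCompact.of_isClosed_subset hb hc fun ρ hρ i _ j _ => ?_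
  have hdiag : ∀ i, 0 ≤ (ρ i i).re ∧ (ρ i i).re ≤ 1 := fun i => by
    have hnn : ∀ i, 0 ≤ (ρ i i).re := fun i => (Complex.le_def.mp hρ.1.diag_nonneg).1
    refine ⟨hnn i, ?_⟩
    have h1 : ∑ i, (ρ i i).re = 1 := by
      have := congrArg Complex.re hρ.2
      simpa [Matrix.trace] using this
    rw [← h1]
    exact Finset.single_le_sum (f := fun i => (ρ i i).re) (fun i _ => hnn i) (Finset.mem_univ i)
  have h2 := hρ.1.norm_apply_sq_le i j
  rw [mem_closedBall_zero_iff]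
  nlinarith [hdiag i, hdiag j, norm_nonneg (ρ i j),
    mul_le_one₀ (hdiag i).2 (hdiag j).1 (hdiag j).2]

theorem Matrix.PosSemidef.eq_zero_or_exists_isState {A : Type*} [Fintype A] {τ : Matrix A A ℂ}
    (hτ : τ.PosSemidef) : τ = 0 ∨ ∃ (t : ℝ) (τ' : Matrix A A ℂ), 0 ≤ t ∧ IsState τ' ∧
      τ = (t : ℂ) • τ' := by
  by_cases h : τ.trace = 0
  · exact .inl (hτ.trace_eq_zero_iff.mp h)
  · right
    have hre : ((τ.trace.re : ℝ) : ℂ) = τ.trace :=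
      (Complex.eq_re_of_ofReal_le (r := 0) (by simpa using hτ.trace_nonneg)).symm
    have hnn : 0 ≤ τ.trace.re := (Complex.le_def.mp hτ.trace_nonneg).1
    refine ⟨τ.trace.re, τ.trace⁻¹ • τ, hnn, ⟨hτ.smul ?_, ?_⟩, ?_⟩
    · rw [← hre, ← Complex.ofReal_inv]
      exact_mod_cast inv_nonneg.mpr hnn
    · rw [Matrix.trace_smul, smul_eq_mul, inv_mul_cancel₀ h]
    · rw [hre, smul_smul, mul_inv_cancel₀ h, one_smul]

namespace IsSeparableOperator

variable {A B : Type*} {σ σ' : Matrix (A × B) (A × B) ℂ}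

theorem kronecker {τ : Matrix A A ℂ} {ω : Matrix B B ℂ} (hτ : τ.PosSemidef)
    (hω : ω.PosSemidef) : IsSeparableOperator (τ ⊗ₖ ω) :=
  ⟨1, fun _ => τ, fun _ => ω, fun _ => hτ, fun _ => hω, by simp⟩

theorem zero : IsSeparableOperator (0 : Matrix (A × B) (A × B) ℂ) :=
  ⟨0, fun i => i.elim0, fun i => i.elim0, fun i => i.elim0, fun i => i.elim0, by simp⟩

theorem add (h : IsSeparableOperator σ) (h' : IsSeparableOperator σ') :
    IsSeparableOperator (σ + σ') := by
  obtain ⟨m, τ, ω, h1, h2, rfl⟩ := h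
  obtain ⟨m', τ', ω', h1', h2', rfl⟩ := h'
  refine ⟨m + m', Fin.append τ τ', Fin.append ω ω', fun i => ?_, fun i => ?_, ?_⟩
  · refine Fin.addCases (fun i => ?_) (fun i => ?_) i <;> simp [h1, h1']
  · refine Fin.addCases (fun i => ?_) (fun i => ?_) i <;> simp [h2, h2']
  · simp [Fin.sum_univ_add]

theorem smul (h : IsSeparableOperator σ) {c : ℝ} (hc : 0 ≤ c) :
    IsSeparableOperator ((c : ℂ) • σ) := by
  obtain ⟨m, τ, ω, h1, h2, rfl⟩ := h
  exact ⟨m, fun i => (c : ℂ) • τ i, ω, fun i => (h1 i).smul (by exact_mod_cast hc), h2, by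
    simp [Finset.smul_sum, Matrix.smul_kronecker]⟩

theorem posSemidef [Finite A] [Finite B] (h : IsSeparableOperator σ) : σ.PosSemidef := by
  have := Fintype.ofFinite A
  have := Fintype.ofFinite B
  obtain ⟨m, τ, ω, h1, h2, rfl⟩ := h
  exact Matrix.posSemidef_sum _ fun i _ => (h1 i).kronecker (h2 i)

theorem one [Finite A] [Finite B] [DecidableEq A] [DecidableEq B] :
    IsSeparableOperator (1 : Matrix (A × B) (A × B) ℂ) := by
  rw [← Matrix.one_kronecker_one]
  exact kronecker .one .one

end IsSeparableOperator

theorem convex_setOf_isSeparableOperator (A B : Type*) :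
    Convex ℝ {σ : Matrix (A × B) (A × B) ℂ | IsSeparableOperator σ} := by
  intro σ hσ σ' hσ' a b ha hb _
  have h := (hσ.smul ha).add (hσ'.smul hb)
  exact h

/-- Every entangled state is detected by a witness. -/
theorem IsEntangledState.exists_witness {A B : Type*} [Fintype A] [Fintype B]
    {ρ : Matrix (A × B) (A × B) ℂ} (hρ : IsEntangledState ρ) :
    ∃ W, IsEntanglementWitness W ∧ (W * ρ).trace.re < 0 := by
  classical
  let s : Set (Matrix (A × B) (A × B) ℂ) :=
    (fun p : Matrix A A ℂ × Matrix B B ℂ => p.1 ⊗ₖ p.2) '' ({τ | IsState τ} ×ˢ {ω | IsState ω})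
  have hcont : Continuous fun p : Matrix A A ℂ × Matrix B B ℂ => p.1 ⊗ₖ p.2 := by
    refine continuous_matrix fun i j => ?_
    simp only [Matrix.kroneckerMap_apply]
    fun_prop
  have hs : IsCompact (convexHull ℝ s) := IsCompact.convexHull_of_finiteDimensional
    (((isCompact_setOf_isState A).prod (isCompact_setOf_isState B)).image hcont)
  have hsep : convexHull ℝ s ⊆ {σ | IsSeparableOperator σ} := by
    refine convexHull_min ?_ (convex_setOf_isSeparableOperator A B)
    rintro _ ⟨⟨τ, ω⟩, ⟨hτ, hω⟩, rfl⟩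
    exact .kronecker hτ.1 hω.1
  have : LocallyConvexSpace ℝ (Matrix (A × B) (A × B) ℂ) :=
    inferInstanceAs (LocallyConvexSpace ℝ (A × B → A × B → ℂ))
  obtain ⟨f, u, hfρ, hf⟩ := RCLike.geometric_hahn_banach_point_closed (𝕜 := ℂ)
    (convex_convexHull ℝ s) hs.isClosed (fun h => hρ.2 (hsep h))
  let M : Matrix (A × B) (A × B) ℂ := Matrix.of fun i j => f (Matrix.single j i 1)
  have hM : ∀ X, f X = (M * X).trace := by
    intro X
    conv_lhs => rw [Matrix.matrix_eq_sum_single X]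
    simp only [map_sum, Matrix.trace, Matrix.diag_apply, Matrix.mul_apply]
    rw [Finset.sum_comm]
    refine Finset.sum_congr rfl fun i _ => Finset.sum_congr rfl fun j _ => ?_
    rw [← mul_one (X j i), ← smul_eq_mul, ← Matrix.smul_single, map_smul, smul_eq_mul, mul_comm,
      smul_eq_mul, mul_one]
    rfl
  -- The Hermitian part of `M` represents `Re f` on Hermitian operators, and subtracting `u` moves
  -- the separating level to `0` on trace one.
  let W := (1 / 2 : ℂ) • (M + M.conjTranspose) - (u : ℂ) • 1
  have hW : ∀ X : Matrix (A × B) (A × B) ℂ, X.IsHermitian → X.trace = 1 →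
      (W * X).trace.re = (f X).re - u := by
    intro X hX hX1
    have h : (M.conjTranspose * X).trace = star (M * X).trace := by
      rw [← Matrix.trace_conjTranspose, Matrix.conjTranspose_mul, hX.eq, Matrix.trace_mul_comm]
    rw [hM]
    simp [W, Matrix.sub_mul, Matrix.add_mul, h, hX1]
    ring
  have hWh : W.IsHermitian := by
    simp [W, Matrix.IsHermitian, add_comm]
  refine ⟨W, ⟨hWh, ?_⟩, ?_⟩
  · rintro _ - ⟨m, τ, ω, hτ, hω, rfl⟩
    rw [Finset.mul_sum, Matrix.trace_sum, Complex.re_sum]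
    refine Finset.sum_nonneg fun i _ => ?_
    obtain h | ⟨t, τ', ht, hτ', h⟩ := (hτ i).eq_zero_or_exists_isState
    · simp [h]
    obtain h' | ⟨t', ω', ht', hω', h'⟩ := (hω i).eq_zero_or_exists_isState
    · simp [h']
    have hmem := hf _ (subset_convexHull ℝ s ⟨(τ', ω'), ⟨hτ', hω'⟩, rfl⟩)
    have hnn : 0 ≤ (W * (τ' ⊗ₖ ω')).trace.re := by
      rw [hW _ (hτ'.1.kronecker hω'.1).1 (by rw [Matrix.trace_kronecker, hτ'.2, hω'.2, one_mul])]
      exact sub_nonneg.mpr hmem.le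
    rw [h, h', Matrix.smul_kronecker, Matrix.kronecker_smul, Matrix.mul_smul, Matrix.mul_smul,
      Matrix.trace_smul, Matrix.trace_smul, smul_eq_mul, smul_eq_mul, Complex.re_ofReal_mul,
      Complex.re_ofReal_mul]
    positivity
  · rw [hW _ hρ.1.1.1 hρ.1.2]
    exact sub_neg.mpr hfρ

/-! ### The identity is an interior point of the separable cone -/

open scoped MatrixOrder Matrix.Norms.L2Operator in
theorem Matrix.IsHermitian.exists_posSemidef_add_sub {A : Type*} [Fintype A] [DecidableEq A]
    {H : Matrix A A ℂ} (hH : H.IsHermitian) : ∃ c : ℝ, 0 ≤ c ∧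
      ((c : ℂ) • (1 : Matrix A A ℂ) + H).PosSemidef ∧
      ((c : ℂ) • (1 : Matrix A A ℂ) - H).PosSemidef := by
  have h1 := IsSelfAdjoint.le_algebraMap_norm_self (a := H) hH
  have h2 := IsSelfAdjoint.neg_algebraMap_norm_le_self (a := H) hH
  rw [Algebra.algebraMap_eq_smul_one, ← Complex.coe_smul] at h1 h2
  refine ⟨‖H‖, norm_nonneg _, ?_, h1⟩
  rw [add_comm, ← sub_neg_eq_add]
  exact h2

/-- `cd 1 + H ⊗ K` is the average of `(c + H) ⊗ (d + K)` and `(c - H) ⊗ (d - K)`. -/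
theorem exists_isSeparableOperator_smul_one_add_kronecker {A B : Type*} [Fintype A] [Fintype B]
    [DecidableEq A] [DecidableEq B] {H : Matrix A A ℂ} {K : Matrix B B ℂ} (hH : H.IsHermitian)
    (hK : K.IsHermitian) : ∃ c : ℝ, 0 ≤ c ∧
      IsSeparableOperator ((c : ℂ) • (1 : Matrix (A × B) (A × B) ℂ) + H ⊗ₖ K) := by
  obtain ⟨c, hc, h1, h2⟩ := hH.exists_posSemidef_add_sub
  obtain ⟨d, hd, h3, h4⟩ := hK.exists_posSemidef_add_sub
  refine ⟨c * d, mul_nonneg hc hd, ?_⟩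
  have h := ((IsSeparableOperator.kronecker h1 h3).add (.kronecker h2 h4)).smul
    (c := 1 / 2) (by norm_num)
  convert h using 1
  ext ⟨i, k⟩ ⟨j, l⟩
  simp [Matrix.one_apply, Prod.ext_iff]
  split_ifs <;> simp_all <;> ring

/-- Averaging the block expansion of `X` with its adjoint leaves terms `(P ⊗ Q + P† ⊗ Q†) / 2`. Each
equals `Re P ⊗ Re Q - Im P ⊗ Im Q` in Hermitian parts, which reduces to Hermitian products. -/
theorem exists_isSeparableOperator_smul_one_add {A B : Type*} [Fintype A] [Fintype B]
    [DecidableEq A] [DecidableEq B] {X : Matrix (A × B) (A × B) ℂ} (hX : X.IsHermitian) :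
    ∃ c : ℝ, 0 ≤ c ∧
      IsSeparableOperator ((c : ℂ) • (1 : Matrix (A × B) (A × B) ℂ) + X) := by
  have hadd : ∀ X Y : Matrix (A × B) (A × B) ℂ,
      (∃ c : ℝ, 0 ≤ c ∧ IsSeparableOperator ((c : ℂ) • (1 : Matrix (A × B) (A × B) ℂ) + X)) →
      (∃ c : ℝ, 0 ≤ c ∧ IsSeparableOperator ((c : ℂ) • (1 : Matrix (A × B) (A × B) ℂ) + Y)) →
      ∃ c : ℝ, 0 ≤ c ∧
        IsSeparableOperator ((c : ℂ) • (1 : Matrix (A × B) (A × B) ℂ) + (X + Y)) := by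
    rintro X Y ⟨c, hc, h⟩ ⟨d, hd, h'⟩
    refine ⟨c + d, add_nonneg hc hd, ?_⟩
    convert h.add h' using 1
    push_cast
    rw [add_smul]
    abel
  have hdec : X = ∑ i, ∑ j, ((1 / 2 : ℂ) •
      (Matrix.single i j 1 ⊗ₖ (Matrix.of fun k l => X (i, k) (j, l)) +
        (Matrix.single i j 1).conjTranspose ⊗ₖ
          (Matrix.of fun k l => X (i, k) (j, l)).conjTranspose)) := by
    have h1 : ∑ i, ∑ j, (Matrix.single i j (1 : ℂ) ⊗ₖ (Matrix.of fun k l => X (i, k) (j, l))) =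
        X := by
      ext ⟨i, k⟩ ⟨j, l⟩
      simp [Matrix.sum_apply, Matrix.single_apply, ite_and]
    simp only [← Matrix.conjTranspose_kronecker, ← Finset.smul_sum, Finset.sum_add_distrib,
      ← Matrix.conjTranspose_sum, h1, hX.eq]
    rw [← two_smul ℂ X, smul_smul]
    norm_num
  have hterm : ∀ (P : Matrix A A ℂ) (Q : Matrix B B ℂ), ∃ c : ℝ, 0 ≤ c ∧
      IsSeparableOperator ((c : ℂ) • (1 : Matrix (A × B) (A × B) ℂ) +
        (1 / 2 : ℂ) • (P ⊗ₖ Q + P.conjTranspose ⊗ₖ Q.conjTranspose)) := by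
    intro P Q
    have h : (1 / 2 : ℂ) • (P ⊗ₖ Q + P.conjTranspose ⊗ₖ Q.conjTranspose) =
        ((1 / 2 : ℂ) • (P + P.conjTranspose)) ⊗ₖ ((1 / 2 : ℂ) • (Q + Q.conjTranspose)) +
        ((Complex.I / 2) • (P - P.conjTranspose)) ⊗ₖ
          ((-Complex.I / 2) • (Q - Q.conjTranspose)) := by
      ext ⟨i, k⟩ ⟨j, l⟩
      simp only [Matrix.smul_apply, Matrix.add_apply, Matrix.sub_apply, Matrix.kroneckerMap_apply,
        smul_eq_mul]
      linear_combination (1 / 4) * (P i j - P.conjTranspose i j) *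
        (Q k l - Q.conjTranspose k l) * Complex.I_mul_I
    rw [h]
    refine hadd _ _ (exists_isSeparableOperator_smul_one_add_kronecker ?_ ?_)
      (exists_isSeparableOperator_smul_one_add_kronecker ?_ ?_)
    · simp [Matrix.IsHermitian, add_comm]
    · simp [Matrix.IsHermitian, add_comm]
    · simp only [Matrix.IsHermitian, Matrix.conjTranspose_smul, Matrix.conjTranspose_sub,
        Matrix.conjTranspose_conjTranspose, star_div₀, star_ofNat, Complex.star_def, Complex.conj_I]
      rw [← neg_sub P, smul_neg, ← neg_smul]
      norm_num [neg_div]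
    · simp only [Matrix.IsHermitian, Matrix.conjTranspose_smul, Matrix.conjTranspose_sub,
        Matrix.conjTranspose_conjTranspose, star_div₀, star_ofNat, Complex.star_def, Complex.conj_I,
        map_neg]
      rw [← neg_sub Q, smul_neg, ← neg_smul]
      norm_num [neg_div]
  have hzero : ∃ c : ℝ, 0 ≤ c ∧
      IsSeparableOperator ((c : ℂ) • (1 : Matrix (A × B) (A × B) ℂ) + 0) :=
    ⟨0, le_rfl, by simpa using IsSeparableOperator.zero⟩
  rw [hdec]
  exact Finset.sum_induction _ _ hadd hzero fun i _ =>
    Finset.sum_induction _ _ hadd hzero fun j _ => hterm _ _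

theorem IsSeparableOperator.one_add_smul {A B : Type*} [Fintype A] [Fintype B]
    [DecidableEq A] [DecidableEq B] {X : Matrix (A × B) (A × B) ℂ} {c ε : ℝ}
    (h : IsSeparableOperator ((c : ℂ) • (1 : Matrix (A × B) (A × B) ℂ) + X)) (hε : 0 ≤ ε)
    (hc : ε * c ≤ 1) : IsSeparableOperator (1 + (ε : ℂ) • X) := by
  convert (h.smul hε).add (IsSeparableOperator.one.smul (sub_nonneg.mpr hc)) using 1
  rw [smul_add, smul_smul]
  push_cast
  module

open scoped Matrix.Norms.Frobenius in
/-- Entangled states are detected by arbitrarily small witnesses. -/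
theorem IsEntangledState.exists_small_witness {A B : Type*} [Fintype A] [Fintype B]
    [DecidableEq A] [DecidableEq B] {ρ : Matrix (A × B) (A × B) ℂ} (hρ : IsEntangledState ρ) :
    ∃ W, IsEntanglementWitness W ∧ frobeniusNorm W ≤ 1 ∧ (W * ρ).trace.re < 0 ∧
      IsSeparableOperator (1 + W) ∧ IsSeparableOperator (1 - W) := by
  obtain ⟨W, hW, hWρ⟩ := hρ.exists_witness
  obtain ⟨c, hc, h⟩ := exists_isSeparableOperator_smul_one_add hW.1
  obtain ⟨d, hd, h'⟩ := exists_isSeparableOperator_smul_one_add hW.1.neg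
  -- One scale dominating `c`, `d` and the norm meets all three bounds after division.
  let s := 1 + c + d + ‖W‖
  have hs : 0 < s := by positivity
  have hle : ∀ x, x ≤ s → s⁻¹ * x ≤ 1 := fun x hx => by
    rw [inv_mul_le_iff₀ hs]; linarith
  have hW0 := norm_nonneg W
  refine ⟨((s⁻¹ : ℝ) : ℂ) • W, ⟨?_, fun σ h1 h2 => ?_⟩, ?_, ?_, ?_, ?_⟩
  · simp [Matrix.IsHermitian, hW.1.eq]
  · rw [Matrix.smul_mul, Matrix.trace_smul, smul_eq_mul, Complex.re_ofReal_mul]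
    exact mul_nonneg (inv_nonneg.mpr hs.le) (hW.2 σ h1 h2)
  · rw [frobeniusNorm, norm_smul, Complex.norm_real, Real.norm_of_nonneg (inv_nonneg.mpr hs.le)]
    exact hle _ (by simp only [s]; linarith)
  · rw [Matrix.smul_mul, Matrix.trace_smul, smul_eq_mul, Complex.re_ofReal_mul]
    exact mul_neg_of_pos_of_neg (inv_pos.mpr hs) hWρ
  · exact h.one_add_smul (inv_nonneg.mpr hs.le) (hle _ (by simp only [s]; linarith))
  · rw [sub_eq_add_neg, ← smul_neg]
    exact h'.one_add_smul (inv_nonneg.mpr hs.le) (hle _ (by simp only [s]; linarith))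

/-! ### Separability and the maximally entangled state -/

theorem phiPlus_apply (p q : Fin 2 × Fin 2) :
    phiPlus p q = if p.1 = p.2 ∧ q.1 = q.2 then 1 / 2 else 0 := by
  simp only [phiPlus, Matrix.vecMulVec_apply, phiPlusVec, Pi.star_apply]
  split_ifs with h1 h2 h3 h3 h3 h3 <;> first | tauto | simp_all
  rw [inv_sqrt_two_mul_self]
  norm_num

theorem posSemidef_phase {x : ℂ} (hx : x * star x = 1) :
    (!![1, star x; x, 1] : Matrix (Fin 2) (Fin 2) ℂ).PosSemidef := by
  convert Matrix.posSemidef_vecMulVec_self_star ![1, x] using 1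
  ext i j
  fin_cases i <;> fin_cases j <;> simp_all [Matrix.vecMulVec_apply]

/-- The isotropic state of fidelity `1 / 2` is an average of product states. -/
theorem isSeparableOperator_one_add_phiPlus :
    IsSeparableOperator (1 + (2 : ℂ) • phiPlus) := by
  have h0 : ∀ i : Fin 2, (Matrix.single i i (1 : ℂ)).PosSemidef := fun i => by
    rw [← Matrix.diagonal_single]
    exact Matrix.PosSemidef.diagonal (Pi.single_nonneg.mpr zero_le_one)
  have hx : ∀ x : ℂ, x * star x = 1 → IsSeparableOperator
      ((!![1, star x; x, 1] : Matrix (Fin 2) (Fin 2) ℂ) ⊗ₖ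
        (!![1, x; star x, 1] : Matrix (Fin 2) (Fin 2) ℂ)) := fun x hx => by
    refine .kronecker (posSemidef_phase hx) ?_
    simpa using posSemidef_phase (x := star x) (by rw [star_star, mul_comm, hx])
  -- Averaging over the fourth roots of unity kills every entry carrying `x`, `x²` or their
  -- conjugates and leaves `1 + |00⟩⟨11| + |11⟩⟨00|`.
  have h := ((IsSeparableOperator.kronecker (h0 0) (h0 0)).add (.kronecker (h0 1) (h0 1))).add
    ((((hx 1 (by simp)).add (hx (-1) (by simp))).add
      ((hx Complex.I (by simp)).add (hx (-Complex.I) (by simp)))).smul (c := 1 / 4) (by norm_num))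
  convert h using 1
  ext ⟨i, j⟩ ⟨k, l⟩
  fin_cases i <;> fin_cases j <;> fin_cases k <;> fin_cases l <;>
    norm_num [phiPlus_apply, Matrix.one_apply, Matrix.single_apply]

theorem trace_phiPlus_mul_nonneg {Y : Matrix (Fin 2 × Fin 2) (Fin 2 × Fin 2) ℂ}
    (hY : Y.PosSemidef) : 0 ≤ (phiPlus * Y).trace := by
  rw [Matrix.trace_mul_comm, ← expectation_phiPlusVec]
  exact expectation_nonneg hY _

/-- Separable operators have fidelity at most `1 / 2` with the maximally entangled state. -/
theorem IsSeparableOperator.two_mul_trace_phiPlus_mul_le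
    {Y : Matrix (Fin 2 × Fin 2) (Fin 2 × Fin 2) ℂ} (hY : IsSeparableOperator Y) :
    2 * (phiPlus * Y).trace ≤ Y.trace := by
  obtain ⟨m, τ, ω, hτ, hω, rfl⟩ := hY
  rw [Finset.mul_sum, Matrix.trace_sum, Matrix.trace_sum, Finset.mul_sum]
  refine Finset.sum_le_sum fun i _ => ?_
  -- The partial transpose of `1 - 2 φ₂⁺` is `1` minus the swap, the rank-one operator of the vector
  -- `|01⟩ - |10⟩`.
  have h := expectation_nonneg ((hτ i).kronecker (hω i).transpose)
    fun p => if p = (0, 1) then 1 else if p = (1, 0) then -1 else 0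
  rw [← sub_nonneg]
  convert h using 1
  change _ = sesqForm _ _ _
  simp [sesqForm_eq_sum, Fintype.sum_prod_type, Matrix.trace, Matrix.mul_apply, phiPlus_apply]
  ring

/-! ### Measure-and-prepare maps -/

/-- The map `X ↦ Tr(P X) Q`. -/
def measurePrepare {A C : Type*} [Fintype A] (P : Matrix A A ℂ) (Q : Matrix C C ℂ) :
    Matrix A A ℂ →ₗ[ℂ] Matrix C C ℂ where
  toFun X := (P * X).trace • Q
  map_add' X Y := by rw [Matrix.mul_add, Matrix.trace_add, add_smul]
  map_smul' c X := by
    rw [Matrix.mul_smul, Matrix.trace_smul, RingHom.id_apply, smul_smul, smul_eq_mul]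

theorem measurePrepare_apply {A C : Type*} [Fintype A] (P : Matrix A A ℂ) (Q : Matrix C C ℂ)
    (X : Matrix A A ℂ) : measurePrepare P Q X = (P * X).trace • Q := rfl

theorem isCompletelyPositive_measurePrepare {A C : Type*} [Fintype A] [Finite C]
    {P : Matrix A A ℂ} {Q : Matrix C C ℂ} (hP : P.PosSemidef) (hQ : Q.PosSemidef) :
    IsCompletelyPositive (measurePrepare P Q) := by
  obtain ⟨m, v, rfl⟩ := Matrix.posSemidef_iff_eq_sum_vecMulVec.mp hP
  obtain ⟨n, w, rfl⟩ := Matrix.posSemidef_iff_eq_sum_vecMulVec.mp hQ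
  convert isCompletelyPositive_krausMap
    (fun p : Fin m × Fin n => Matrix.vecMulVec (w p.2) (star (v p.1))) using 1
  ext1 X
  have h : ∀ i j, Matrix.vecMulVec (w j) (star (v i)) * X *
      (Matrix.vecMulVec (w j) (star (v i))).conjTranspose =
      (Matrix.vecMulVec (v i) (star (v i)) * X).trace • Matrix.vecMulVec (w j) (star (w j)) := by
    intro i j
    rw [Matrix.conjTranspose_vecMulVec, star_star, Matrix.vecMulVec_mul,
      Matrix.vecMulVec_mul_vecMulVec, Matrix.vecMulVec_mul, Matrix.trace_vecMulVec,
      dotProduct_comm (v i), Matrix.vecMulVec_smul]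
  simp only [measurePrepare_apply, krausMap_apply, Fintype.sum_prod_type, h, Finset.sum_mul,
    Matrix.trace_sum, Finset.sum_smul, Finset.smul_sum]
  exact Finset.sum_comm

theorem IsCompletelyPositive.add {A C : Type*} {Λ Θ : Matrix A A ℂ →ₗ[ℂ] Matrix C C ℂ}
    (h : IsCompletelyPositive Λ) (h' : IsCompletelyPositive Θ) :
    IsCompletelyPositive (Λ + Θ) := fun k M hM => (h k M hM).add (h' k M hM)

theorem Matrix.PosSemidef.trace_mul_nonneg {A : Type*} [Fintype A] {P X : Matrix A A ℂ}
    (hP : P.PosSemidef) (hX : X.PosSemidef) : 0 ≤ (P * X).trace := by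
  obtain ⟨R, rfl⟩ := Matrix.exists_eq_conjTranspose_mul_self hX
  rw [← Matrix.mul_assoc, Matrix.trace_mul_comm, ← Matrix.mul_assoc]
  exact (hP.mul_mul_conjTranspose_same R).trace_nonneg

theorem Matrix.IsHermitian.trace_mul_eq_ofReal {A : Type*} [Fintype A] {P X : Matrix A A ℂ}
    (hP : P.IsHermitian) (hX : X.IsHermitian) : (P * X).trace = (((P * X).trace.re : ℝ) : ℂ) := by
  symm
  rw [← Complex.conj_eq_iff_re, ← Complex.star_def, ← Matrix.trace_conjTranspose,
    Matrix.conjTranspose_mul, hP.eq, hX.eq, Matrix.trace_mul_comm]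

theorem IsEntanglementWitness.trace_mul_nonneg {A B : Type*} [Fintype A] [Fintype B]
    {W σ : Matrix (A × B) (A × B) ℂ} (hW : IsEntanglementWitness W) (hσ : IsSeparableOperator σ) :
    0 ≤ (W * σ).trace.re := by
  obtain h | ⟨t, σ', ht, hσ', h⟩ := hσ.posSemidef.eq_zero_or_exists_isState
  · simp [h]
  · rcases ht.eq_or_lt with rfl | ht'
    · simp [h]
    · have hsep : IsSeparableOperator σ' := by
        have := hσ.smul (inv_nonneg.mpr ht)
        rwa [h, smul_smul, Complex.ofReal_inv, inv_mul_cancel₀ (by exact_mod_cast ht'.ne'),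
          one_smul] at this
      rw [h, Matrix.mul_smul, Matrix.trace_smul, smul_eq_mul, Complex.re_ofReal_mul]
      exact mul_nonneg ht (hW.2 σ' hσ' hsep)

theorem dualMap_measurePrepare_add {A C : Type*} [Fintype A] [Fintype C] [DecidableEq A]
    (P P' : Matrix A A ℂ) (Q Q' : Matrix C C ℂ) :
    dualMap (measurePrepare P Q + measurePrepare P' Q') =
      measurePrepare Q P + measurePrepare Q' P' := by
  refine (eq_dualMap _ _ fun X Y => ?_).symm
  simp only [LinearMap.add_apply, measurePrepare_apply, Matrix.add_mul, Matrix.mul_add,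
    Matrix.smul_mul, Matrix.mul_smul, Matrix.trace_add, Matrix.trace_smul, smul_eq_mul,
    Matrix.trace_mul_comm X, mul_comm]

/-- The two-qubit state prepared by a test that fails with probability `p`. -/
theorem smul_one_add_smul_phiPlus_eq_isoMatrix (p : ℝ) :
    (p : ℂ) • ((1 / 4 : ℂ) • (1 : Matrix (Fin 2 × Fin 2) (Fin 2 × Fin 2) ℂ)) +
      (1 - (p : ℂ)) • phiPlus = isoMatrix (1 / 2 - p / 4) (p / 4) ((1 - p) / 2) := by
  ext ⟨i, j⟩ ⟨k, l⟩
  fin_cases i <;> fin_cases j <;> fin_cases k <;> fin_cases l <;>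
    simp [phiPlus_apply, isoMatrix] <;> ring

/-! ### The channel built from a witness -/

section Channel

variable {A B : Type*} [Fintype A] [Fintype B] [DecidableEq A] [DecidableEq B]
  {W : Matrix (A × B) (A × B) ℂ}

theorem posSemidef_test (hW : IsSeparableOperator (1 + W)) :
    ((1 / 3 : ℂ) • (W + (2 : ℂ) • 1)).PosSemidef := by
  have h : (1 / 3 : ℂ) • (W + (2 : ℂ) • 1) = ((1 / 3 : ℝ) : ℂ) • ((1 + W) + 1) := by
    push_cast
    module
  rw [h]
  exact ((hW.add .one).smul (by norm_num)).posSemidef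

theorem posSemidef_one_sub_test (hW : IsSeparableOperator (1 - W)) :
    (1 - (1 / 3 : ℂ) • (W + (2 : ℂ) • 1)).PosSemidef := by
  have h : 1 - (1 / 3 : ℂ) • (W + (2 : ℂ) • 1) = ((1 / 3 : ℝ) : ℂ) • (1 - W) := by
    push_cast
    module
  rw [h]
  exact (hW.smul (by norm_num)).posSemidef

theorem posSemidef_smul_one {C : Type*} [DecidableEq C] :
    ((1 / 4 : ℂ) • (1 : Matrix C C ℂ)).PosSemidef := by
  have h : (1 / 4 : ℂ) = ((1 / 4 : ℝ) : ℂ) := by push_cast; rfl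
  rw [h]
  exact Matrix.PosSemidef.one.smul (by exact_mod_cast (by norm_num : (0 : ℝ) ≤ 1 / 4))

/-- The output is `(r/4) 1 + ((t - r)/6) (1 + 2 φ₂⁺)`, where `r ≥ 0` by the witness property and `r
≤ t` because `1 - W` is positive. -/
theorem isSeparableOperator_map (hW : IsEntanglementWitness W) (hW' : IsSeparableOperator (1 - W))
    {σ : Matrix (A × B) (A × B) ℂ} (hσ : IsSeparableOperator σ) :
    IsSeparableOperator
      ((((1 / 3 : ℂ) • (W + (2 : ℂ) • 1)) * σ).trace •
          ((1 / 4 : ℂ) • (1 : Matrix (Fin 2 × Fin 2) (Fin 2 × Fin 2) ℂ)) +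
        ((1 - (1 / 3 : ℂ) • (W + (2 : ℂ) • 1)) * σ).trace • phiPlus) := by
  have hr := hW.trace_mul_nonneg hσ
  have hrt := (Complex.le_def.mp (hW'.posSemidef.trace_mul_nonneg hσ.posSemidef)).1
  rw [Matrix.sub_mul, Matrix.trace_sub, Complex.sub_re, Complex.zero_re] at hrt
  have h1 := hW.1.trace_mul_eq_ofReal hσ.posSemidef.1
  have h2 := (Matrix.isHermitian_one (n := A × B) (α := ℂ)).trace_mul_eq_ofReal hσ.posSemidef.1
  set r := (W * σ).trace.re
  set t := ((1 : Matrix (A × B) (A × B) ℂ) * σ).trace.re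
  convert (IsSeparableOperator.one.smul (show 0 ≤ r / 4 by linarith)).add
    (isSeparableOperator_one_add_phiPlus.smul (show 0 ≤ (t - r) / 6 by linarith)) using 1
  simp only [Matrix.sub_mul, Matrix.add_mul, Matrix.smul_mul, Matrix.trace_sub, Matrix.trace_add,
    Matrix.trace_smul, h1, h2, smul_eq_mul]
  push_cast
  module

/-- With `s = Tr(φ₂⁺ Y)` and `t = Tr Y`, the output is `((t - 2s)/12) (2 + W) + (s/6) (4 - W)`. The
first coefficient is nonnegative because separable operators satisfy `2s ≤ t`. -/
theorem isSeparableOperator_dual (hW : IsSeparableOperator (1 + W))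
    (hW' : IsSeparableOperator (1 - W)) {Y : Matrix (Fin 2 × Fin 2) (Fin 2 × Fin 2) ℂ}
    (hY : IsSeparableOperator Y) :
    IsSeparableOperator
      ((((1 / 4 : ℂ) • (1 : Matrix (Fin 2 × Fin 2) (Fin 2 × Fin 2) ℂ)) * Y).trace •
          ((1 / 3 : ℂ) • (W + (2 : ℂ) • 1)) +
        (phiPlus * Y).trace • (1 - (1 / 3 : ℂ) • (W + (2 : ℂ) • 1))) := by
  have hs := (Complex.le_def.mp (trace_phiPlus_mul_nonneg hY.posSemidef)).1
  have hst := (Complex.le_def.mp hY.two_mul_trace_phiPlus_mul_le).1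
  have h1 := posSemidef_phiPlus.1.trace_mul_eq_ofReal hY.posSemidef.1
  have h2 := (Matrix.isHermitian_one (n := Fin 2 × Fin 2) (α := ℂ)).trace_mul_eq_ofReal
    hY.posSemidef.1
  rw [Matrix.one_mul] at h2
  rw [Complex.zero_re] at hs
  rw [h1, ← Complex.ofReal_ofNat, Complex.re_ofReal_mul, Complex.ofReal_re] at hst
  set s := (phiPlus * Y).trace.re
  set t := Y.trace.re
  convert ((hW.add .one).smul (show 0 ≤ (t - 2 * s) / 12 by linarith)).add
    (((hW'.add .one).add (IsSeparableOperator.one.add .one)).smul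
      (show 0 ≤ s / 6 by linarith)) using 1
  simp only [Matrix.smul_mul, Matrix.one_mul, Matrix.trace_smul, h1, h2, smul_eq_mul]
  push_cast
  module

/-- The channel that prepares `φ₂⁺` or the maximally mixed state, depending on a test of `W`. -/
def witnessChannel (W : Matrix (A × B) (A × B) ℂ) :
    Matrix (A × B) (A × B) ℂ →ₗ[ℂ] Matrix (Fin 2 × Fin 2) (Fin 2 × Fin 2) ℂ :=
  measurePrepare ((1 / 3 : ℂ) • (W + (2 : ℂ) • 1)) ((1 / 4 : ℂ) • 1) +
    measurePrepare (1 - (1 / 3 : ℂ) • (W + (2 : ℂ) • 1)) phiPlus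

theorem witnessChannel_apply (W X : Matrix (A × B) (A × B) ℂ) :
    witnessChannel W X =
      (((1 / 3 : ℂ) • (W + (2 : ℂ) • 1)) * X).trace •
          ((1 / 4 : ℂ) • (1 : Matrix (Fin 2 × Fin 2) (Fin 2 × Fin 2) ℂ)) +
        ((1 - (1 / 3 : ℂ) • (W + (2 : ℂ) • 1)) * X).trace • phiPlus := rfl

theorem isQuantumChannel_witnessChannel (hW : IsSeparableOperator (1 + W))
    (hW' : IsSeparableOperator (1 - W)) : IsQuantumChannel (witnessChannel W) := by
  refine ⟨(isCompletelyPositive_measurePrepare (posSemidef_test hW) posSemidef_smul_one).add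
    (isCompletelyPositive_measurePrepare (posSemidef_one_sub_test hW') posSemidef_phiPlus),
    fun X => ?_⟩
  simp only [witnessChannel_apply, Matrix.trace_add, Matrix.trace_smul, trace_phiPlus,
    Matrix.trace_one, Matrix.sub_mul, Matrix.one_mul, Matrix.trace_sub, smul_eq_mul]
  norm_num

theorem isDuallyNonEntangling_witnessChannel (hW : IsEntanglementWitness W)
    (hadd : IsSeparableOperator (1 + W)) (hsub : IsSeparableOperator (1 - W)) :
    IsDuallyNonEntangling (witnessChannel W) := by
  refine ⟨⟨(isQuantumChannel_witnessChannel hadd hsub).1,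
    fun σ hσ => isSeparableOperator_map hW hsub hσ⟩, ?_⟩
  rw [witnessChannel, dualMap_measurePrepare_add]
  exact ⟨(isCompletelyPositive_measurePrepare posSemidef_smul_one (posSemidef_test hadd)).add
    (isCompletelyPositive_measurePrepare posSemidef_phiPlus (posSemidef_one_sub_test hsub)),
    fun Y hY => isSeparableOperator_dual hadd hsub hY⟩

theorem isState_witnessChannel (hadd : IsSeparableOperator (1 + W))
    (hsub : IsSeparableOperator (1 - W)) {ρ : Matrix (A × B) (A × B) ℂ} (hρ : IsState ρ) :
    IsState (witnessChannel W ρ) :=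
  ⟨(posSemidef_smul_one.smul ((posSemidef_test hadd).trace_mul_nonneg hρ.1)).add
    (posSemidef_phiPlus.smul ((posSemidef_one_sub_test hsub).trace_mul_nonneg hρ.1)),
    ((isQuantumChannel_witnessChannel hadd hsub).2 ρ).trans hρ.2⟩

end Channel

end

theorem mainTheorem2 {A B : Type*} [Fintype A] [DecidableEq A] [Fintype B] [DecidableEq B]
    (ρ : Matrix (A × B) (A × B) ℂ) (hρ : IsEntangledState ρ) :
    ∃ Λ : Matrix (A × B) (A × B) ℂ →ₗ[ℂ] Matrix (Fin 2 × Fin 2) (Fin 2 × Fin 2) ℂ,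
      IsQuantumChannel Λ ∧ IsDuallyNonEntangling Λ ∧
      1 / 2 < (Λ ρ * phiPlus).trace.re ∧
      IsLOCCDistillable (Λ ρ) ∧
      ∃ W : Matrix (A × B) (A × B) ℂ,
        IsEntanglementWitness W ∧ frobeniusNorm W ≤ 1 ∧ (W * ρ).trace.re < 0 ∧
        ∀ X, Λ X =
          (((1 / 3 : ℂ) • (W + (2 : ℂ) • 1)) * X).trace •
              ((1 / 4 : ℂ) • (1 : Matrix (Fin 2 × Fin 2) (Fin 2 × Fin 2) ℂ)) +
            ((1 - (1 / 3 : ℂ) • (W + (2 : ℂ) • 1)) * X).trace • phiPlus := by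
  obtain ⟨W, hW, hW1, hWρ, hadd, hsub⟩ := hρ.exists_small_witness
  have hst := isState_witnessChannel hadd hsub hρ.1
  have hWρ' := hW.1.trace_mul_eq_ofReal hρ.1.1.1
  have hA : (((1 / 3 : ℂ) • (W + (2 : ℂ) • 1)) * ρ).trace =
      ((((W * ρ).trace.re + 2) / 3 : ℝ) : ℂ) := by
    simp only [Matrix.smul_mul, Matrix.add_mul, Matrix.one_mul, Matrix.trace_smul,
      Matrix.trace_add, smul_eq_mul, hρ.1.2]
    generalize (W * ρ).trace.re = r at hWρ'
    rw [hWρ']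
    push_cast
    ring
  have hA0 := (Complex.le_def.mp ((posSemidef_test hadd).trace_mul_nonneg hρ.1.1)).1
  rw [hA, Complex.ofReal_re, Complex.zero_re] at hA0
  -- `p < 2/3` is the exact threshold for both remaining claims: `1 - 3p/4 > 1/2`, and `p/4 < (1 -
  -- p)/2`, which is `b < c`.
  have hp : ((W * ρ).trace.re + 2) / 3 < 2 / 3 := by linarith
  have hiso : witnessChannel W ρ = (((((W * ρ).trace.re + 2) / 3 : ℝ)) : ℂ) •
        ((1 / 4 : ℂ) • (1 : Matrix (Fin 2 × Fin 2) (Fin 2 × Fin 2) ℂ)) +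
      (1 - (((((W * ρ).trace.re + 2) / 3 : ℝ)) : ℂ)) • phiPlus := by
    rw [witnessChannel_apply, Matrix.sub_mul, Matrix.trace_sub, hA, Matrix.one_mul, hρ.1.2]
  refine ⟨witnessChannel W, isQuantumChannel_witnessChannel hadd hsub,
    isDuallyNonEntangling_witnessChannel hW hadd hsub, ?_, ?_,
    W, hW, hW1, hWρ, witnessChannel_apply W⟩
  · rw [hiso]
    generalize ((W * ρ).trace.re + 2) / 3 = p at hp
    have h : (((p : ℂ) • ((1 / 4 : ℂ) • (1 : Matrix (Fin 2 × Fin 2) (Fin 2 × Fin 2) ℂ)) +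
        (1 - (p : ℂ)) • phiPlus) * phiPlus).trace = ((1 - 3 / 4 * p : ℝ) : ℂ) := by
      simp only [Matrix.add_mul, Matrix.smul_mul, Matrix.one_mul, phiPlus_mul_self,
        Matrix.trace_add, Matrix.trace_smul, trace_phiPlus, smul_eq_mul]
      push_cast
      ring
    rw [h, Complex.ofReal_re]
    linarith
  · rw [hiso, smul_one_add_smul_phiPlus_eq_isoMatrix] at hst ⊢
    exact isLOCCDistillable_isoMatrix (by linarith) (by linarith) (by linarith) hst
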